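/- **Conventions.** A digraph $G=(V,E)$ consists of countable sets $V$, $E$ and maps sending each edge $e$ to its tail $e^-$ and head $e^+$ (loops and parallel edges are allowed). It is *connected* if it is connected as an undirected graph, and *locally finite* if all in- and out-degrees are finite. It is *transient* if every vertex has at least one outgoing edge (so that the random walk, which at each step crosses a uniformly random edge out of its current location, is defined) and, from every starting vertex, the random walk almost surely visits each vertex at most finitely often. A *spanning in-arborescence of $G$ rooted at $z\in V$* is a set $A\subseteq E$ such that every vertex other than $z$ has out-degree $1$ in $A$, the vertex $z$ has out-degree $0$ in $A$, and every vertex is joined to $z$ by a directed path in $A$. If $G$ is finite and such sets exist, $\mathsf{UA}_{G,z}$ denotes the uniform distribution on them. A *spanning in-arboretum of $G$ rooted at infinity* is a set $A\subseteq E$ in which every vertex has out-degree $1$ and whose underlying undirected graph is a forest; it need not be connected. Its *components are all one-ended* if for every vertex $u$ the set of vertices from which there is a directed path in $A$ to $u$ is finite. Measures on sets of edges are measures on $\{0,1\}^E$ with the product topology, and limits are weak limits. Let $G$ be infinite, locally finite and connected. A *partial isomorphism* $\Phi$ from a digraph $H$ to $G$ is a pair of bijections, from a set of vertices of $H$ to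 a set of vertices of $G$ and from a set of edges of $H$ to a set of edges of $G$, such that the endpoints of every edge in the domain lie in the domain and tails and heads are respected. A *finite approximation* to $G$ is a sequence $(G_n,z_n,\Phi_n)$ of finite digraphs $G_n$ with a vertex $z_n$ of $G_n$ that can be reached from every vertex of $G_n$ and a partial isomorphism $\Phi_n$ from $G_n$ to $G$, such that for every finite $W\subseteq V$ and all sufficiently large $n$: $W$ is contained in the range of $\Phi_n$, $\Phi_n$ maps the set of edges incident to $\Phi_n^{-1}(W)$ bijectively onto the set of edges incident to $W$, and $z_n\notin\Phi_n^{-1}(W)$. A probability measure $\mu$ on the set of spanning in-arboreta of $G$ rooted at infinity is a *Gibbs measure* if $$\mu=\lim_{n\to\infty}\int \Phi_n^*(\mathsf{UA}_{G_n,z_n})\,\mathrm d\nu$$ for some probability measure $\nu$ on the space of finite approximations to $G$, where $\Phi_n^*$ is the pushforward under $A\mapsto\Phi_n(A)$. For a finite $W\subseteq V$ let $G_W^*$ be the digraph obtained by identifying all vertices of $V\setminus W$ into a single vertex $\partial$ and deleting all edges with both endpoints at $\partial$; its edges are identified with the edges of $G$ having an endpoint in $W$. The *wired uniform spanning in-arboretum*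 $\mathsf{WUA}_G$ is the measure such that, for every increasing sequence $(V_n)$ of finite sets with union $V$, the measures $\mathsf{UA}_{G_{V_n}^*,\partial}$ are defined and converge weakly to $\mathsf{WUA}_G$. **Theorem.** Let $G$ be an infinite, locally finite, connected, transient digraph. Then there is at most one Gibbs measure on spanning in-arboreta of $G$ rooted at infinity that is supported on configurations in which every component is one-ended. Moreover, if such a measure exists, then it is equal to $\mathsf{WUA}_G$. -/

import Mathlib

open MeasureTheory ProbabilityTheory Filter Topology

/-- A directed multigraph with vertex set `V` and edge set `E`. Loops and parallel edges
are allowed. -/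
structure MultiDigraph (V : Type*) (E : Type*) where
  /-- The tail (starting vertex) of an edge. -/
  tail : E → V
  /-- The head (final vertex) of an edge. -/
  head : E → V

namespace MultiDigraph

section Basic

variable {V E : Type*}

/-- The edges pointing out of `v`. -/
def outEdges (G : MultiDigraph V E) (v : V) : Set E := {e | G.tail e = v}

/-- The edges pointing into `v`. -/
def inEdges (G : MultiDigraph V E) (v : V) : Set E := {e | G.head e = v}

/-- The edges with at least one endpoint in `S`. -/
def incidentEdges (G : MultiDigraph V E) (S : Set V) : Set E :=
  {e | G.tail e ∈ S ∨ G.head e ∈ S}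

/-- Every vertex has finite out-degree and finite in-degree. -/
def LocallyFinite (G : MultiDigraph V E) : Prop :=
  ∀ v, (G.outEdges v).Finite ∧ (G.inEdges v).Finite

/-- `G.Step A x y`: some edge of `A` goes from `x` to `y`. -/
def Step (G : MultiDigraph V E) (A : Set E) (x y : V) : Prop :=
  ∃ e ∈ A, G.tail e = x ∧ G.head e = y

/-- Any two vertices are joined by a path that may cross edges in either direction. -/
def IsConnected (G : MultiDigraph V E) : Prop :=
  ∀ x y, Relation.EqvGen (G.Step Set.univ) x y

/-! ### Arborescences and arboreta

A spanning subdigraph of `G` is given by its set `A` of edges. -/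

/-- `A` is the edge set of a spanning in-arborescence of `G` rooted at the vertex `z`. -/
def IsSpanningInArborescence (G : MultiDigraph V E) (z : V) (A : Set E) : Prop :=
  (∀ v, v ≠ z → ∃! e, e ∈ A ∧ G.tail e = v) ∧
  (∀ e ∈ A, G.tail e ≠ z) ∧
  ∀ v, Relation.ReflTransGen (G.Step A) v z

/-- `A` is the edge set of a spanning in-arboretum of `G` rooted at infinity: every vertex has
out-degree one in `A`, and `A` has no cycles. (As all out-degrees are one, every cycle of the
underlying undirected multigraph of `A` is a directed cycle.) -/
def IsSpanningInArboretum (G : MultiDigraph V E) (A : Set E) : Prop :=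
  (∀ v, ∃! e, e ∈ A ∧ G.tail e = v) ∧
  ∀ v, ¬ Relation.TransGen (G.Step A) v v

/-- The past of `u` in `A`: the vertices from which a directed path in `A` leads to `u`. -/
def past (G : MultiDigraph V E) (A : Set E) (u : V) : Set V :=
  {x | Relation.ReflTransGen (G.Step A) x u}

/-- Every component of `A` is one-ended: the past of each vertex is finite. -/
def ComponentsOneEnded (G : MultiDigraph V E) (A : Set E) : Prop :=
  ∀ u, (G.past A u).Finite

/-- The uniform distribution on the spanning in-arborescences rooted at `z` of a digraph with
finitely many edges, provided there are any. -/
noncomputable def uniformArborescence [Finite E] (G : MultiDigraph V E) (z : V)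
    (h : ∃ A, G.IsSpanningInArborescence z A) : PMF (Set E) :=
  PMF.uniformOfFinset (Set.toFinite {A | G.IsSpanningInArborescence z A}).toFinset
    ((Set.Finite.toFinset_nonempty _).2 h)

end Basic

/-! ### Random walk and transience -/

section Walk

variable {V E : Type*}

/-- The distribution of one step of the random walk from `v`: a uniform random edge pointing out
of `v` is crossed. -/
noncomputable def stepPMF (G : MultiDigraph V E) (hG : G.LocallyFinite)
    (hne : ∀ v, (G.outEdges v).Nonempty) (v : V) : PMF V :=
  (PMF.uniformOfFinset (hG v).1.toFinset (by simpa using hne v)).map G.head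

/-- The transition kernel of the random walk. -/
noncomputable def stepKernel [Countable V] [MeasurableSpace V] [MeasurableSingletonClass V]
    (G : MultiDigraph V E) (hG : G.LocallyFinite) (hne : ∀ v, (G.outEdges v).Nonempty) :
    Kernel V V :=
  Kernel.ofFunOfCountable fun v => (G.stepPMF hG hne v).toMeasure

instance [Countable V] [MeasurableSpace V] [MeasurableSingletonClass V]
    (G : MultiDigraph V E) (hG : G.LocallyFinite) (hne : ∀ v, (G.outEdges v).Nonempty) :
    IsMarkovKernel (G.stepKernel hG hne) :=
  ⟨fun v => PMF.toMeasure.isProbabilityMeasure (G.stepPMF hG hne v)⟩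

/-- The law of the sequence of vertices visited by the random walk started at `x`, as given by the
theorem of Ionescu-Tulcea. -/
noncomputable def walkLaw [Countable V] [MeasurableSpace V] [MeasurableSingletonClass V]
    (G : MultiDigraph V E) (hG : G.LocallyFinite) (hne : ∀ v, (G.outEdges v).Nonempty) (x : V) :
    Measure (ℕ → V) :=
  Kernel.traj (X := fun _ => V)
    (fun n => (G.stepKernel hG hne).comap
      (fun h : (i : Finset.Iic n) → V => h ⟨n, Finset.mem_Iic.2 le_rfl⟩) (measurable_pi_apply _))
    0 (fun _ => x)

/-- The random walk is defined (every vertex has an outgoing edge), and from every starting point it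
almost surely visits each vertex at most finitely often. -/
def IsTransient [Countable V] (G : MultiDigraph V E) (hG : G.LocallyFinite) : Prop :=
  ∃ hne : ∀ v, (G.outEdges v).Nonempty,
    letI : MeasurableSpace V := ⊤
    haveI : MeasurableSingletonClass V := ⟨fun _ => trivial⟩
    ∀ x, ∀ᵐ X ∂(G.walkLaw hG hne x), ∀ y, {n | X n = y}.Finite

end Walk

end MultiDigraph

/-- Sets of edges, encoded by their indicator functions. This space carries the product topology
and the product sigma-algebra. -/
abbrev EdgeConfig (E : Type*) := E → Bool

namespace EdgeConfig

/-- The set of edges encoded by `ω`. -/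
def edges {E : Type*} (ω : EdgeConfig E) : Set E := {e | ω e = true}

open scoped Classical in
/-- The indicator function of the set `A`. -/
noncomputable def ofSet {E : Type*} (A : Set E) : EdgeConfig E := fun e => decide (e ∈ A)

end EdgeConfig

namespace MultiDigraph

/-! ### The wired uniform spanning in-arboretum -/

section Wired

variable {V E : Type*}

open scoped Classical in
/-- The digraph obtained from `G` by identifying all vertices outside `W` to a single boundary
vertex `none` and deleting all edges from the boundary vertex to itself. -/
noncomputable def wired (G : MultiDigraph V E) (W : Finset V) :
    MultiDigraph (Option W) (G.incidentEdges (W : Set V)) where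
  tail e := if h : G.tail e ∈ W then some ⟨G.tail e, h⟩ else none
  head e := if h : G.head e ∈ W then some ⟨G.head e, h⟩ else none

theorem LocallyFinite.finite_incidentEdges {G : MultiDigraph V E} (hG : G.LocallyFinite)
    (W : Finset V) : Finite (G.incidentEdges (W : Set V)) := by
  have h : (⋃ v ∈ (W : Set V), (G.outEdges v ∪ G.inEdges v)).Finite :=
    W.finite_toSet.biUnion fun v _ => (hG v).1.union (hG v).2
  refine (h.subset ?_).to_subtype
  rintro e (he | he)
  · exact Set.mem_biUnion he (Or.inl rfl)
  · exact Set.mem_biUnion he (Or.inr rfl)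

/-- The law of the uniform spanning in-arborescence of `G.wired W` rooted at the boundary vertex,
as a measure on sets of edges of `G`. -/
noncomputable def wiredLaw (G : MultiDigraph V E) (hG : G.LocallyFinite) (W : Finset V)
    (h : ∃ A, (G.wired W).IsSpanningInArborescence none A) :
    ProbabilityMeasure (EdgeConfig E) :=
  haveI := hG.finite_incidentEdges W
  ⟨(((G.wired W).uniformArborescence none h).map
    fun A => EdgeConfig.ofSet (Subtype.val '' A)).toMeasure,
    PMF.toMeasure.isProbabilityMeasure _⟩

/-- An increasing sequence of finite sets of vertices with union `V`. -/
def IsExhaustion (W : ℕ → Finset V) : Prop :=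
  Monotone W ∧ ∀ v, ∃ n, v ∈ W n

/-- `μ` is the wired uniform spanning in-arboretum measure of `G`: along every exhaustion, the
uniform spanning in-arborescences of the wired digraphs rooted at the boundary vertex exist, and
their laws converge weakly to `μ`. -/
def IsWiredUniformArboretum [Countable E] (G : MultiDigraph V E) (hG : G.LocallyFinite)
    (μ : ProbabilityMeasure (EdgeConfig E)) : Prop :=
  ∀ W : ℕ → Finset V, IsExhaustion W →
    ∃ h : ∀ n, ∃ A, (G.wired (W n)).IsSpanningInArborescence none A,
      Tendsto (fun n => G.wiredLaw hG (W n) (h n)) atTop (𝓝 μ)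

end Wired

/-! ### Finite approximations and Gibbs measures -/

section Gibbs

variable {V E V' E' : Type*}

/-- A partial isomorphism from `G` to `G'`: a bijection between a set of vertices of `G` and a set
of vertices of `G'`, and a bijection between a set of edges of `G` and a set of edges of `G'`, that
respect tails and heads. -/
structure PartialIso (G : MultiDigraph V E) (G' : MultiDigraph V' E') where
  /-- The partial bijection between vertices. -/
  vert : V ≃. V'
  /-- The partial bijection between edges. -/
  edge : E ≃. E'
  tail_mem : ∀ e e', e' ∈ edge e → G'.tail e' ∈ vert (G.tail e)
  head_mem : ∀ e e', e' ∈ edge e → G'.head e' ∈ vert (G.head e)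

namespace PartialIso

variable {G : MultiDigraph V E} {G' : MultiDigraph V' E'}

/-- The preimage of a set of vertices. -/
def vertPreimage (Φ : PartialIso G G') (W : Set V') : Set V := {u | ∃ w ∈ W, w ∈ Φ.vert u}

/-- The image of a set of edges. -/
def edgeImage (Φ : PartialIso G G') (A : Set E) : Set E' := {e' | ∃ e ∈ A, e' ∈ Φ.edge e}

end PartialIso

/-- One term of a finite approximation to `G`: a finite digraph with a sink vertex and a partial
isomorphism to `G`. Up to isomorphism, the finite digraph has vertex set `Fin nV` and edge set
`Fin nE`. It is required to have a spanning in-arborescence rooted at the sink, so that there is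
a uniform one. -/
structure Approximant (G : MultiDigraph V E) where
  nV : ℕ
  nE : ℕ
  graph : MultiDigraph (Fin nV) (Fin nE)
  sink : Fin nV
  iso : PartialIso graph G
  exists_arborescence : ∃ A, graph.IsSpanningInArborescence sink A

instance (G : MultiDigraph V E) : MeasurableSpace (Approximant G) := ⊤

/-- The law of the image under the partial isomorphism of the uniform spanning in-arborescence
rooted at the sink. -/
noncomputable def Approximant.law {G : MultiDigraph V E} (a : Approximant G) :
    ProbabilityMeasure (EdgeConfig E) :=
  ⟨((a.graph.uniformArborescence a.sink a.exists_arborescence).map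
    fun A => EdgeConfig.ofSet (a.iso.edgeImage A)).toMeasure,
    PMF.toMeasure.isProbabilityMeasure _⟩

/-- The defining properties of a finite approximation to `G`. -/
structure IsFiniteApproximation (G : MultiDigraph V E) (a : ℕ → Approximant G) : Prop where
  /-- Divergent radius of identification. -/
  identification : ∀ W : Finset V, ∃ N, ∀ n ≥ N,
    (∀ w ∈ W, ∃ u, w ∈ (a n).iso.vert u) ∧
    Set.BijOn (a n).iso.edge
      ((a n).graph.incidentEdges ((a n).iso.vertPreimage W))
      (some '' G.incidentEdges W)
  /-- The sink goes to infinity. -/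
  sink_escapes : ∀ W : Finset V, ∃ N, ∀ n ≥ N, (a n).sink ∉ (a n).iso.vertPreimage W

/-- The space of finite approximations to `G`, with the product of the discrete
sigma-algebras. -/
abbrev FiniteApproximation (G : MultiDigraph V E) :=
  {a : ℕ → Approximant G // IsFiniteApproximation G a}

theorem measurable_law (G : MultiDigraph V E) (n : ℕ) :
    Measurable fun a : FiniteApproximation G => ((a.1 n).law : Measure (EdgeConfig E)) := by
  have h : Measurable fun b : Approximant G => (b.law : Measure (EdgeConfig E)) :=
    fun _ _ => trivial
  exact h.comp ((measurable_pi_apply n).comp measurable_subtype_coe)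

/-- The average over a random finite approximation with law `ν` of the law of the image of the
uniform spanning in-arborescence on its `n`-th term. -/
noncomputable def averagedLaw (G : MultiDigraph V E)
    (ν : ProbabilityMeasure (FiniteApproximation G)) (n : ℕ) :
    ProbabilityMeasure (EdgeConfig E) :=
  ⟨(ν : Measure (FiniteApproximation G)).bind
      fun a => ((a.1 n).law : Measure (EdgeConfig E)), by
    constructor
    rw [Measure.bind_apply MeasurableSet.univ (measurable_law G n).aemeasurable]
    simp⟩

/-- `μ` is a Gibbs measure on spanning in-arboreta of `G` rooted at infinity: it is supported on
such arboreta, and it is a weak limit of the laws of uniform spanning in-arborescences on the terms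
of some random finite approximation to `G`. -/
def IsGibbsMeasure [Countable E] (G : MultiDigraph V E)
    (μ : ProbabilityMeasure (EdgeConfig E)) : Prop :=
  (∀ᵐ ω ∂(μ : Measure (EdgeConfig E)), G.IsSpanningInArboretum ω.edges) ∧
  ∃ ν : ProbabilityMeasure (FiniteApproximation G),
    Tendsto (fun n => G.averagedLaw ν n) atTop (𝓝 μ)

end Gibbs

end MultiDigraph

/-!
Write `P_W` for the uniform spanning in-arborescence of the wired digraph of a finite set `W`, that
is, for the uniform random choice of one outgoing edge for each vertex of `W` under which every
vertex of `W` eventually leaves `W` (a *rooted forest* of `W`). The theorem rests on two facts.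

*The laws `P_W` converge as `W` exhausts the digraph.* By the directed matrix-tree theorem
(`MultiDigraph.ncard_isRootedForest`), the number of rooted forests of `W` that contain a finite
set `F` of edges is the determinant of a Laplacian on `W`, in which only the rows of the tails of
`F` depend on `F`. Dividing by the determinant of the full Laplacian, whose inverse is the
normalized Green function of the walk killed outside `W`, gives the probability that `F` is present
as a determinant of fixed size whose entries are values of this Green function
(`MultiDigraph.det_laplacian_eq`). On a transient digraph the Green function of the whole digraph
is finite, and is the limit of the killed ones by dominated convergence
(`MultiDigraph.IsTransient.summable_killedProb`, `MultiDigraph.tendsto_killedGreen`). Hence the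
probabilities converge (`MultiDigraph.exists_tendsto_forestProb`).

*A Gibbs measure `μ` with one-ended components is a mixture of the laws `P_W` for large `W`.* Given
a finite set `Λ` of vertices, let the *past interior* `W` of `Λ` in a configuration be the set of
vertices whose past is contained in `Λ`. The event that the past interior is a given set depends
only on the edges out of its complement, and on it no edge enters `W` from outside. So in a finite
digraph, given that the past interior is `W`, the edges out of `W` form a uniform rooted forest of
`W`. As the past interior of `Λ` is a local function of the configuration, this Markov property
passes to `μ` (`MultiDigraph.IsGibbsMeasure.real_inter`). If all pasts are finite, then the past
interior of `Λ` increases to the whole vertex set as `Λ` does, so the probability under `μ` that `F`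
is present is the limit of those under `P_W` (`MultiDigraph.IsGibbsMeasure.real_containing_eq`).

These probabilities determine a measure and, the space of configurations being compact, their
convergence is weak convergence.
-/

/-! ### Rooted forests and the directed matrix-tree theorem -/

namespace MultiDigraph

section RootedForest

variable {V E : Type*}

/-- `B` is a spanning forest of `W` rooted at the complement of `W`: it consists of exactly one
edge out of each vertex of `W`, and following these edges leads out of `W`. -/
def IsRootedForest (G : MultiDigraph V E) (W : Set V) (B : Set E) : Prop :=
  (∀ e ∈ B, G.tail e ∈ W) ∧ (∀ v ∈ W, ∃! e, e ∈ B ∧ G.tail e = v) ∧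
    ∀ v, ∃ u, u ∉ W ∧ Relation.ReflTransGen (G.Step B) v u

theorem isSpanningInArborescence_iff_isRootedForest (G : MultiDigraph V E) (z : V) (A : Set E) :
    G.IsSpanningInArborescence z A ↔ G.IsRootedForest {z}ᶜ A := by
  simp [IsSpanningInArborescence, IsRootedForest]
  tauto

open scoped Classical in
/-- If each vertex `v` of `W` is sent to `h v`, the matrix `1 - P`, where `P` is the transition
matrix killed outside `W`, has determinant `1` or `0`, according to whether all orbits leave `W`. -/
theorem det_one_sub_map (W : Finset V) (h : W → V) :
    Matrix.det (fun v w : W => (if v = w then (1 : ℝ) else 0) - if h v = w then 1 else 0) =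
      if ∀ v, Acc (fun w v : W => h v = w) v then 1 else 0 := by
  set M : Matrix W W ℝ :=
    fun v w : W => (if v = w then (1 : ℝ) else 0) - if h v = w then 1 else 0 with hM
  split_ifs with hacc
  · -- The matrix is block triangular, with identity blocks, for the rank of the relation.
    have hwf : WellFounded (fun w v : W => h v = w) := ⟨hacc⟩
    have : IsWellFounded W (fun w v : W => h v = w) := ⟨hwf⟩
    let b : W → Ordinalᵒᵈ :=
      fun v => OrderDual.toDual (IsWellFounded.rank (fun w v : W => h v = w) v)
    have hlt : ∀ v w : W, h v = w → b v < b w := fun v w hvw =>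
      OrderDual.toDual_lt_toDual.2 (IsWellFounded.rank_lt_of_rel (r := fun w v : W => h v = w) hvw)
    have hbt : M.BlockTriangular b := by
      intro v w hvw
      have h1 : v ≠ w := by rintro rfl; exact lt_irrefl _ hvw
      have h2 : h v ≠ w := fun h2 => lt_asymm hvw (hlt v w h2)
      simp [hM, h1, h2]
    rw [hbt.det]
    refine Finset.prod_eq_one fun a _ => ?_
    have : M.toSquareBlock b a = 1 := by
      ext ⟨v, hv⟩ ⟨w, hw⟩
      have h2 : h v ≠ w := fun h2 => by
        have := hlt v w h2
        rw [hv, hw] at this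
        exact lt_irrefl _ this
      change M v w = _
      simp [hM, h2, Matrix.one_apply, Subtype.mk.injEq]
    rw [this, Matrix.det_one]
  · -- The indicator of the set of vertices that never leave `W` is in the kernel.
    push Not at hacc
    obtain ⟨v₀, hv₀⟩ := hacc
    refine Matrix.exists_mulVec_eq_zero_iff.1
      ⟨fun v => if Acc (fun w v : W => h v = w) v then 0 else 1, ?_, ?_⟩
    · intro h0
      have := congrFun h0 v₀
      simp [hv₀] at this
    · ext v
      have hstep : Acc (fun w v : W => h v = w) v ↔
          ∀ w : W, h v = w → Acc (fun w v : W => h v = w) w :=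
        ⟨fun hv w hw => hv.inv hw, fun hv => ⟨v, hv⟩⟩
      simp only [Matrix.mulVec, dotProduct, hM, sub_mul, Finset.sum_sub_distrib, ite_mul, one_mul,
        zero_mul, Finset.sum_ite_eq, Finset.mem_univ, if_true, Pi.zero_apply]
      by_cases hW : h v ∈ W
      · rw [Finset.sum_eq_single (⟨h v, hW⟩ : W)]
        · have : Acc (fun w v : W => h v = w) v ↔ Acc (fun w v : W => h v = w) ⟨h v, hW⟩ := by
            rw [hstep]
            exact ⟨fun H => H _ rfl, fun H w hw => by
              have : w = ⟨h v, hW⟩ := Subtype.ext hw.symm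
              rwa [this]⟩
          simp [this]
        · intro w _ hw
          rw [if_neg fun h' => hw (Subtype.ext h'.symm)]
        · simp
      · rw [Finset.sum_eq_zero]
        · have : Acc (fun w v : W => h v = w) v :=
            hstep.2 fun w hw => absurd (hw ▸ w.2) hW
          simp [this]
        · intro w _
          rw [if_neg fun h' => hW (by rw [h']; exact w.2)]

/-- The range of a choice of one outgoing edge per vertex of `W` is a
rooted forest iff the relation "is the head of the chosen edge of" is well-founded on `W`. -/
theorem isRootedForest_range_iff (G : MultiDigraph V E) (W : Finset V) (f : W → E)
    (hf : ∀ v, G.tail (f v) = v) :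
    G.IsRootedForest W (Set.range f) ↔ ∀ v, Acc (fun w v : W => G.head (f v) = w) v := by
  constructor
  · rintro ⟨-, -, h3⟩
    have key : ∀ v u, u ∉ W → Relation.ReflTransGen (G.Step (Set.range f)) v u →
        ∀ hv : v ∈ W, Acc (fun w v : W => G.head (f v) = w) ⟨v, hv⟩ := by
      intro v u hu huv
      induction huv using Relation.ReflTransGen.head_induction_on with
      | refl => intro hv; exact absurd hv hu
      | head hab _ ih =>
        intro hv
        refine ⟨_, fun w hw => ?_⟩
        obtain ⟨_, ⟨x, rfl⟩, hx1, hx2⟩ := hab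
        have hxv : x = ⟨_, hv⟩ := Subtype.ext ((hf x).symm.trans hx1)
        subst hxv
        have : w.1 = _ := hw.symm.trans hx2
        subst this
        exact ih w.2
    intro v
    obtain ⟨u, hu, hvu⟩ := h3 v
    exact key v u hu hvu v.2
  · intro hacc
    refine ⟨?_, ?_, ?_⟩
    · rintro _ ⟨v, rfl⟩
      rw [hf]; exact v.2
    · intro v hv
      refine ⟨f ⟨v, hv⟩, ⟨⟨_, rfl⟩, hf _⟩, ?_⟩
      rintro _ ⟨⟨x, rfl⟩, hx⟩
      exact congrArg f (Subtype.ext ((hf x).symm.trans hx))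
    · have key : ∀ v : W, ∃ u, u ∉ (W : Set V) ∧
          Relation.ReflTransGen (G.Step (Set.range f)) v u := by
        intro v
        induction hacc v with
        | intro v _ ih =>
          have hs : G.Step (Set.range f) v (G.head (f v)) := ⟨f v, ⟨v, rfl⟩, hf v, rfl⟩
          by_cases hW : G.head (f v) ∈ W
          · obtain ⟨u, hu, hp⟩ := ih ⟨_, hW⟩ rfl
            exact ⟨u, hu, hp.head hs⟩
          · exact ⟨_, hW, .single hs⟩
      intro v
      by_cases hv : v ∈ W
      · exact key ⟨v, hv⟩
      · exact ⟨v, hv, .refl⟩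

/-- The edges out of `v` that are compatible with containing the set `F`. -/
def compatibleEdges (G : MultiDigraph V E) (F : Finset E) (v : V) : Set E :=
  {e | e ∈ G.outEdges v ∧ ∀ e' ∈ F, G.tail e' = v → e' = e}

theorem LocallyFinite.finite_compatibleEdges {G : MultiDigraph V E} (hG : G.LocallyFinite)
    (F : Finset E) (v : V) : (G.compatibleEdges F v).Finite :=
  (hG v).1.subset fun _ h => h.1

open scoped Classical in
/-- The Laplacian of `G` with Dirichlet boundary conditions outside `W`, computed from the edges
that are compatible with `F`. -/
noncomputable def laplacian (G : MultiDigraph V E) (hG : G.LocallyFinite) (F : Finset E)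
    (W : Finset V) : Matrix W W ℝ :=
  fun v w => ∑ e ∈ (hG.finite_compatibleEdges F (v : V)).toFinset,
    ((if v = w then (1 : ℝ) else 0) - if G.head e = w then 1 else 0)

open scoped Classical in
/-- **Directed matrix-tree theorem**, for rooted forests that contain a given set of edges. -/
theorem ncard_isRootedForest (G : MultiDigraph V E) (hG : G.LocallyFinite) (F : Finset E)
    (W : Finset V) (hF : ∀ e ∈ F, G.tail e ∈ W) :
    ({B | G.IsRootedForest W B ∧ (F : Set E) ⊆ B}.ncard : ℝ) = (G.laplacian hG F W).det := by
  let O : W → Finset E := fun v => (hG.finite_compatibleEdges F (v : V)).toFinset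
  have hO : ∀ v e, e ∈ O v ↔ G.tail e = v ∧ ∀ e' ∈ F, G.tail e' = v → e' = e := by
    intro v e; simp [O, compatibleEdges, outEdges]
  -- Expand the determinant by multilinearity: choose one compatible edge in each row.
  have hdet : (G.laplacian hG F W).det = ∑ f ∈ Fintype.piFinset O,
      Matrix.det (n := W) (R := ℝ) (fun v w => (if v = w then (1 : ℝ) else 0) -
        if G.head (f v) = w then 1 else 0) := by
    have := (Matrix.detRowAlternating (n := W) (R := ℝ)).toMultilinearMap.map_sum_finset
      (fun (v : W) (e : E) (w : W) =>
        (if v = w then (1 : ℝ) else 0) - if G.head e = w then 1 else 0) O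
    refine Eq.trans ?_ this
    change Matrix.det _ = Matrix.det _
    congr 1
    · ext v w
      simp [laplacian, O, Finset.sum_apply]
  rw [hdet]
  simp_rw [det_one_sub_map]
  rw [Finset.sum_boole]
  have hinj : ∀ f ∈ (Fintype.piFinset O).filter
      (fun f => ∀ v, Acc (fun w v : W => G.head (f v) = w) v),
      ∀ v, G.tail (f v) = v := fun f hf v =>
    ((hO v _).1 (Fintype.mem_piFinset.1 (Finset.mem_filter.1 hf).1 v)).1
  have hset : {B | G.IsRootedForest W B ∧ (F : Set E) ⊆ B} =
      (((Fintype.piFinset O).filter (fun f => ∀ v, Acc (fun w v : W => G.head (f v) = w) v)).image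
        Set.range : Finset (Set E)) := by
    ext B
    simp only [Set.mem_ofPred_eq, Finset.coe_image, Set.mem_image, SetLike.mem_coe]
    constructor
    · rintro ⟨hB, hFB⟩
      choose f hf hf' using hB.2.1
      let g : W → E := fun v => f v v.2
      have hg : ∀ v, G.tail (g v) = v := fun v => (hf v v.2).2
      have hgB : Set.range g = B := by
        ext e
        constructor
        · rintro ⟨v, rfl⟩
          exact (hf v v.2).1
        · intro he
          exact ⟨⟨_, hB.1 e he⟩, (hf' _ (hB.1 e he) e ⟨he, rfl⟩).symm⟩
      refine ⟨g, Finset.mem_filter.2 ⟨Fintype.mem_piFinset.2 fun v => (hO _ _).2 ⟨hg v, ?_⟩, ?_⟩,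
        hgB⟩
      · intro e he hev
        exact hf' v v.2 e ⟨hFB he, hev⟩
      · rw [← isRootedForest_range_iff G W g hg, hgB]
        exact hB
    · rintro ⟨f, hf, rfl⟩
      refine ⟨(isRootedForest_range_iff G W f (hinj f hf)).2 (Finset.mem_filter.1 hf).2, ?_⟩
      intro e he
      exact ⟨⟨_, hF e he⟩, (((hO _ _).1 (Fintype.mem_piFinset.1 (Finset.mem_filter.1 hf).1
        ⟨_, hF e he⟩)).2 e he rfl).symm⟩
  rw [hset, Set.ncard_coe_finset, Finset.card_image_of_injOn]
  intro f hf g hg hfg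
  ext v
  have : f v ∈ Set.range g := hfg ▸ ⟨v, rfl⟩
  obtain ⟨w, hw⟩ := this
  have : w = v := Subtype.ext (by rw [← hinj g hg w, hw, hinj f hf v])
  rw [← hw, this]

end RootedForest

end MultiDigraph

/-! ### Green functions and edge probabilities -/

namespace MultiDigraph

section Green

variable {V E : Type*}

open scoped Classical in
/-- The probability that the random walk started at `x` is at `y` after `n` steps and has not left
`W` by then. -/
noncomputable def killedProb (G : MultiDigraph V E) (hG : G.LocallyFinite) (W : Set V) (y : V) :
    ℕ → V → ℝ
  | 0, x => if x ∈ W ∧ x = y then 1 else 0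
  | n + 1, x => if x ∈ W then
      (∑ e ∈ (hG x).1.toFinset, killedProb G hG W y n (G.head e)) / (hG x).1.toFinset.card
      else 0

variable (G : MultiDigraph V E) (hG : G.LocallyFinite)

theorem killedProb_nonneg (W : Set V) (y : V) (n : ℕ) (x : V) :
    0 ≤ G.killedProb hG W y n x := by
  induction n generalizing x with
  | zero => rw [killedProb]; split_ifs <;> norm_num
  | succ n ih =>
    rw [killedProb]
    split_ifs
    · exact div_nonneg (Finset.sum_nonneg fun e _ => ih _) (Nat.cast_nonneg _)
    · exact le_rfl

theorem killedProb_le_univ (W : Set V) (y : V) (n : ℕ) (x : V) :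
    G.killedProb hG W y n x ≤ G.killedProb hG Set.univ y n x := by
  induction n generalizing x with
  | zero =>
    rw [killedProb, killedProb]
    split_ifs <;> simp_all
  | succ n ih =>
    rw [killedProb, killedProb, if_pos (Set.mem_univ x)]
    split_ifs
    · gcongr with e _
      exact ih _
    · exact div_nonneg (Finset.sum_nonneg fun e _ => G.killedProb_nonneg hG _ _ _ _)
        (Nat.cast_nonneg _)

theorem eventually_killedProb_eq_univ (y : V) (n : ℕ) (x : V) :
    ∀ᶠ W : Finset V in atTop, G.killedProb hG W y n x = G.killedProb hG Set.univ y n x := by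
  induction n generalizing x with
  | zero =>
    filter_upwards [eventually_ge_atTop {x}] with W hW
    have : x ∈ (W : Set V) := hW (Finset.mem_singleton_self x)
    rw [killedProb, killedProb]
    split_ifs <;> simp_all
  | succ n ih =>
    have := (Filter.eventually_all_finset (hG x).1.toFinset).2 fun e _ => ih (G.head e)
    filter_upwards [eventually_ge_atTop {x}, this] with W hW hs
    have hx : x ∈ W := hW (Finset.mem_singleton_self x)
    simp only [killedProb, Finset.mem_coe, hx, Set.mem_univ, if_true]
    rw [Finset.sum_congr rfl hs]

theorem killedProb_le_one (hne : ∀ v, (G.outEdges v).Nonempty) (y : V) (n : ℕ) (x : V) :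
    G.killedProb hG Set.univ y n x ≤ 1 := by
  induction n generalizing x with
  | zero => rw [killedProb]; split_ifs <;> norm_num
  | succ n ih =>
    have hcard : 0 < ((hG x).1.toFinset.card : ℝ) := by
      have := (hne x)
      simpa [Finset.card_pos] using this
    rw [killedProb, if_pos (Set.mem_univ x), div_le_one hcard]
    simpa using Finset.sum_le_sum fun e (_ : e ∈ (hG x).1.toFinset) => ih (G.head e)

open scoped Classical in
theorem ofReal_killedProb_zero (y x : V) :
    ENNReal.ofReal (G.killedProb hG Set.univ y 0 x) = if x = y then 1 else 0 := by
  rw [killedProb]; split_ifs <;> simp_all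

/-- The expected number of visits to `y` before leaving `W` of the walk started at `x`. -/
noncomputable def killedGreen (W : Set V) (x y : V) : ℝ := ∑' n, G.killedProb hG W y n x

theorem killedGreen_of_notMem {W : Set V} {x : V} (hx : x ∉ W) (y : V) :
    G.killedGreen hG W x y = 0 := by
  have : ∀ n, G.killedProb hG W y n x = 0 := by
    intro n
    cases n <;> simp [killedProb, hx]
  simp [killedGreen, this]

variable {G hG}

theorem summable_killedProb (hs : ∀ x y, Summable fun n => G.killedProb hG Set.univ y n x)
    (W : Set V) (x y : V) : Summable fun n => G.killedProb hG W y n x :=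
  (hs x y).of_nonneg_of_le (fun n => G.killedProb_nonneg hG W y n x)
    fun n => G.killedProb_le_univ hG W y n x

theorem tendsto_killedGreen (hs : ∀ x y, Summable fun n => G.killedProb hG Set.univ y n x)
    (x y : V) : Tendsto (fun W : Finset V => G.killedGreen hG W x y) atTop
      (𝓝 (G.killedGreen hG Set.univ x y)) := by
  refine tendsto_tsum_of_dominated_convergence (hs x y) (fun n => ?_)
    (Eventually.of_forall fun W n => ?_)
  · exact (tendsto_congr' (G.eventually_killedProb_eq_univ hG y n x)).2 tendsto_const_nhds
  · rw [Real.norm_of_nonneg (G.killedProb_nonneg hG _ _ _ _)]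
    exact G.killedProb_le_univ hG _ _ _ _

open scoped Classical in
/-- Decomposition of the Green function according to the first step. -/
theorem sum_killedGreen_sub (hs : ∀ x y, Summable fun n => G.killedProb hG Set.univ y n x)
    (hne : ∀ v, (G.outEdges v).Nonempty) {W : Set V} {x : V} (hx : x ∈ W) (y : V) :
    ∑ e ∈ (hG x).1.toFinset, (G.killedGreen hG W x y - G.killedGreen hG W (G.head e) y) =
      if x = y then ((hG y).1.toFinset.card : ℝ) else 0 := by
  have hcard : ((hG x).1.toFinset.card : ℝ) ≠ 0 := by
    have := (hne x)
    simpa [Finset.card_eq_zero] using this.ne_empty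
  have h1 : G.killedGreen hG W x y = (if x = y then 1 else 0) +
      (∑ e ∈ (hG x).1.toFinset, G.killedGreen hG W (G.head e) y) /
        (hG x).1.toFinset.card := by
    rw [killedGreen, (summable_killedProb hs W x y).tsum_eq_zero_add]
    simp only [killedProb, hx, true_and, if_true, killedGreen]
    rw [tsum_div_const, Summable.tsum_finsetSum fun e _ => summable_killedProb hs W _ y]
  rw [Finset.sum_sub_distrib, Finset.sum_const, nsmul_eq_mul, h1]
  split_ifs with h
  · subst h
    field_simp
    ring
  · field_simp
    ring

open scoped Classical in
/-- The block, with rows and columns indexed by the tails of the edges of `F`, of the product of the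
Laplacian for the edges compatible with `F` and the inverse of the full Laplacian. The other rows of
this product are rows of the identity matrix. -/
noncomputable def transferMatrix (G : MultiDigraph V E) (hG : G.LocallyFinite) (F : Finset E)
    (W : Set V) : Matrix (F.image G.tail) (F.image G.tail) ℝ :=
  fun v w => (∑ e ∈ (hG.finite_compatibleEdges F (v : V)).toFinset,
    (G.killedGreen hG W v w - G.killedGreen hG W (G.head e) w)) / (hG w).1.toFinset.card

/-- The inverse of the Laplacian on `W`: the Green function divided by the out-degree of the
vertex that is visited. -/
noncomputable def greenMatrix (G : MultiDigraph V E) (hG : G.LocallyFinite) (W : Finset V) :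
    Matrix W W ℝ :=
  fun v w => G.killedGreen hG W v w / (hG w).1.toFinset.card

open scoped Classical in
theorem laplacian_mul_greenMatrix (F : Finset E) (W : Finset V) (v w : W) :
    (G.laplacian hG F W * G.greenMatrix hG W) v w =
    (∑ e ∈ (hG.finite_compatibleEdges F (v : V)).toFinset,
      (G.killedGreen hG W v w - G.killedGreen hG W (G.head e) w)) / (hG w).1.toFinset.card := by
  rw [Matrix.mul_apply]
  simp only [laplacian, greenMatrix, Finset.sum_mul]
  rw [Finset.sum_comm, Finset.sum_div]
  refine Finset.sum_congr rfl fun e _ => ?_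
  simp only [sub_mul, Finset.sum_sub_distrib, ite_mul, one_mul, zero_mul, Finset.sum_ite_eq,
    Finset.mem_univ, if_true, sub_div]
  congr 1
  by_cases hW : G.head e ∈ W
  · rw [Finset.sum_eq_single (⟨G.head e, hW⟩ : W)]
    · simp
    · intro b _ hb
      rw [if_neg fun h' => hb (Subtype.ext h'.symm)]
    · simp
  · rw [killedGreen_of_notMem _ _ (by simpa using hW), zero_div]
    refine Finset.sum_eq_zero fun b _ => ?_
    rw [if_neg fun h' => hW (by rw [h']; exact b.2)]

open scoped Classical in
/-- The transfer-current theorem for directed graphs: the proportion of rooted forests of `W` that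
contain `F` is a determinant whose size does not depend on `W`. -/
theorem det_laplacian_eq (hs : ∀ x y, Summable fun n => G.killedProb hG Set.univ y n x)
    (hne : ∀ v, (G.outEdges v).Nonempty) (F : Finset E) (W : Finset V)
    (hF : ∀ e ∈ F, G.tail e ∈ W) :
    (G.laplacian hG ∅ W).det ≠ 0 ∧
    (G.laplacian hG F W).det / (G.laplacian hG ∅ W).det = (G.transferMatrix hG F W).det := by
  set N : Matrix W W ℝ := G.greenMatrix hG W with hN
  have hcard : ∀ x, ((hG x).1.toFinset.card : ℝ) ≠ 0 := by
    intro x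
    have := (hne x)
    simpa [Finset.card_eq_zero] using this.ne_empty
  have hrow : ∀ (F' : Finset E) (v w : W), (∀ e ∈ F', G.tail e ≠ v) →
      (G.laplacian hG F' W * N) v w = (1 : Matrix W W ℝ) v w := by
    intro F' v w hv
    rw [hN, laplacian_mul_greenMatrix]
    have : (hG.finite_compatibleEdges F' (v : V)).toFinset = (hG v).1.toFinset := by
      ext e
      simp only [Set.Finite.mem_toFinset, compatibleEdges]
      exact ⟨fun h => h.1, fun h => ⟨h, fun e' he' h' => absurd h' (hv e' he')⟩⟩
    rw [this, sum_killedGreen_sub hs hne (by simp)]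
    by_cases h : v = w
    · subst h
      simp [hcard]
    · have : (v : V) ≠ w := fun h' => h (Subtype.ext h')
      simp [h, this]
  have hLN : G.laplacian hG ∅ W * N = 1 := by
    ext v w
    exact hrow ∅ v w (by simp)
  have hdet : (G.laplacian hG ∅ W).det * N.det = 1 := by
    rw [← Matrix.det_mul, hLN, Matrix.det_one]
  have h0 : (G.laplacian hG ∅ W).det ≠ 0 := left_ne_zero_of_mul_eq_one hdet
  refine ⟨h0, ?_⟩
  -- The rows without tails of edges of `F` are those of the identity matrix, so the determinant
  -- reduces to the block of the remaining rows.
  have hratio : (G.laplacian hG F W).det / (G.laplacian hG ∅ W).det =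
      (G.laplacian hG F W * N).det := by
    rw [Matrix.det_mul, div_eq_iff h0, mul_assoc, mul_comm N.det, hdet, mul_one]
  rw [hratio]
  set K := F.image G.tail with hK
  have hKW : K ⊆ W := by
    intro v hv
    obtain ⟨e, he, rfl⟩ := Finset.mem_image.1 hv
    exact hF e he
  have hrow' : ∀ v : W, (v : V) ∉ K → ∀ w, (G.laplacian hG F W * N) v w =
      (1 : Matrix W W ℝ) v w := fun v hv w => hrow F v w fun e he h' =>
    hv (h' ▸ Finset.mem_image_of_mem _ he)
  rw [Matrix.twoBlockTriangular_det _ (fun v : W => (v : V) ∈ K)]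
  · have h1 : (G.laplacian hG F W * N).toSquareBlockProp (fun v : W => (v : V) ∉ K) = 1 := by
      ext ⟨v, hv⟩ ⟨w, hw⟩
      simp only [Matrix.toSquareBlockProp, Matrix.toBlock_apply]
      exact (hrow' v hv w).trans (by simp [Matrix.one_apply, Subtype.mk.injEq])
    rw [h1, Matrix.det_one, mul_one]
    let φ : K ≃ {v : W // (v : V) ∈ K} :=
      ⟨fun v => ⟨⟨v, hKW v.2⟩, v.2⟩, fun v => ⟨v.1, v.2⟩, fun _ => rfl, fun _ => rfl⟩
    rw [← Matrix.det_submatrix_equiv_self φ]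
    congr 1
    ext v w
    exact laplacian_mul_greenMatrix (hG := hG) F W ⟨v, hKW v.2⟩ ⟨w, hKW w.2⟩
  · intro v hv w hw
    rw [hrow' v hv, Matrix.one_apply_ne]
    rintro rfl
    exact hv hw

open scoped Classical in
theorem tendsto_det_transferMatrix
    (hs : ∀ x y, Summable fun n => G.killedProb hG Set.univ y n x) (F : Finset E) :
    Tendsto (fun W : Finset V => (G.transferMatrix hG F W).det) atTop
      (𝓝 (G.transferMatrix hG F Set.univ).det) := by
  have hM : Tendsto (fun W : Finset V => G.transferMatrix hG F W) atTop
      (𝓝 (G.transferMatrix hG F Set.univ)) := by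
    refine tendsto_pi_nhds.2 fun v => tendsto_pi_nhds.2 fun w => ?_
    exact (tendsto_finsetSum _ fun e _ =>
      (tendsto_killedGreen hs _ _).sub (tendsto_killedGreen hs _ _)).div_const _
  exact ((continuous_id.matrix_det).tendsto _).comp hM

/-- The probability that a uniform rooted forest of `W` contains `F`. -/
noncomputable def forestProb (G : MultiDigraph V E) (W : Set V) (F : Finset E) : ℝ :=
  ({B | G.IsRootedForest W B ∧ (F : Set E) ⊆ B}.ncard : ℝ) / {B | G.IsRootedForest W B}.ncard

theorem ncard_isRootedForest_pos (hs : ∀ x y, Summable fun n => G.killedProb hG Set.univ y n x)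
    (hne : ∀ v, (G.outEdges v).Nonempty) (W : Finset V) :
    0 < {B | G.IsRootedForest W B}.ncard := by
  classical
  have h := (det_laplacian_eq hs hne ∅ W (by simp)).1
  rw [← ncard_isRootedForest G hG ∅ W (by simp)] at h
  simpa [Nat.pos_iff_ne_zero] using h

/-- Convergence of the probabilities that a finite set of edges is contained in the uniform rooted
forests of growing finite sets of vertices. -/
theorem exists_tendsto_forestProb (hs : ∀ x y, Summable fun n => G.killedProb hG Set.univ y n x)
    (hne : ∀ v, (G.outEdges v).Nonempty) (F : Finset E) :
    ∃ c, Tendsto (fun W : Finset V => G.forestProb W F) atTop (𝓝 c) := by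
  classical
  refine ⟨_, (tendsto_congr' ?_).2 (tendsto_det_transferMatrix hs F)⟩
  filter_upwards [eventually_ge_atTop (F.image G.tail)] with W hW
  have hF : ∀ e ∈ F, G.tail e ∈ W := fun e he => hW (Finset.mem_image_of_mem _ he)
  rw [← (det_laplacian_eq hs hne F W hF).2, ← ncard_isRootedForest G hG F W hF,
    ← ncard_isRootedForest G hG ∅ W (by simp)]
  simp [forestProb]

end Green

end MultiDigraph

/-! ### Finiteness of the Green function on transient digraphs -/

namespace MultiDigraph

section WalkGreen

open scoped ENNReal

variable {V E : Type*}

/-- The trajectories whose first visit to `y` at a time at least `N` is at time `N + m`. -/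
def firstVisit (y : V) (N m : ℕ) : Set (ℕ → V) :=
  {X | X (N + m) = y ∧ ∀ j < m, X (N + j) ≠ y}

open scoped Classical in
/-- Decomposition of the visits to `y` after time `N` at the first such visit. -/
theorem sum_visits_le (y : V) (N M : ℕ) (X : ℕ → V) :
    ∑ n ∈ Finset.range M, (if X (N + n) = y then (1 : ℝ≥0∞) else 0) ≤
      ∑ m ∈ Finset.range M, ∑ k ∈ Finset.range M,
        (firstVisit y N m).indicator 1 X * (if X (N + m + k) = y then 1 else 0) := by
  by_cases h : ∃ n, n < M ∧ X (N + n) = y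
  · obtain ⟨m, hmM, hmy, hmin⟩ : ∃ m < M, X (N + m) = y ∧ ∀ j < m, X (N + j) ≠ y :=
      ⟨Nat.find h, (Nat.find_spec h).1, (Nat.find_spec h).2, fun j hj hy =>
        Nat.find_min h hj ⟨hj.trans (Nat.find_spec h).1, hy⟩⟩
    have hX : X ∈ firstVisit y N m := ⟨hmy, hmin⟩
    refine le_trans ?_ (Finset.single_le_sum
      (f := fun m => ∑ k ∈ Finset.range M,
        (firstVisit y N m).indicator 1 X * (if X (N + m + k) = y then (1 : ℝ≥0∞) else 0))
      (fun _ _ => zero_le) (Finset.mem_range.2 hmM))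
    simp only [Set.indicator_of_mem hX, Pi.one_apply, one_mul]
    obtain ⟨r, hr⟩ := Nat.exists_eq_add_of_le hmM.le
    rw [hr, Finset.sum_range_add, Finset.sum_eq_zero, zero_add]
    · simp only [add_assoc]
      exact Finset.sum_le_sum_of_subset (Finset.range_mono (Nat.le_add_left _ _))
    · intro j hj
      exact if_neg (hmin j (Finset.mem_range.1 hj))
  · push Not at h
    rw [Finset.sum_eq_zero]
    · exact zero_le
    · intro n hn
      exact if_neg (h n (Finset.mem_range.1 hn))

variable [MeasurableSpace V] [MeasurableSingletonClass V]

theorem measurableSet_visit (y : V) (n : ℕ) : MeasurableSet {X : ℕ → V | X n = y} :=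
  show MeasurableSet ((fun X : ℕ → V => X n) ⁻¹' {y}) from
    measurable_pi_apply n (measurableSet_singleton y)

theorem measurableSet_firstVisit (y : V) (N m : ℕ) : MeasurableSet (firstVisit y N m) := by
  have : firstVisit y N m = {X | X (N + m) = y} ∩ ⋂ j, ⋂ _ : j < m, {X | X (N + j) = y}ᶜ := by
    ext X; simp [firstVisit]
  rw [this]
  exact (measurableSet_visit y _).inter
    (.iInter fun j => .iInter fun _ => (measurableSet_visit y _).compl)

variable [Countable V] (G : MultiDigraph V E) (hG : G.LocallyFinite)
  (hne : ∀ v, (G.outEdges v).Nonempty)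

instance (x : V) : IsProbabilityMeasure (G.walkLaw hG hne x) := by
  unfold walkLaw; infer_instance

theorem lintegral_stepKernel [Countable E] (g : V → ℝ≥0∞) (x : V) :
    ∫⁻ z, g z ∂(G.stepKernel hG hne x) =
      (∑ e ∈ (hG x).1.toFinset, g (G.head e)) / (hG x).1.toFinset.card := by
  classical
  let _ : MeasurableSpace E := ⊤
  have hh : Measurable G.head := fun _ _ => trivial
  change ∫⁻ z, g z ∂((PMF.uniformOfFinset (hG x).1.toFinset _).map G.head).toMeasure = _
  rw [← PMF.toMeasure_map _ _ hh, lintegral_map (Measurable.of_discrete) hh, lintegral_countable']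
  have h1 : ∀ e, (PMF.uniformOfFinset (hG x).1.toFinset
      (by simpa using hne x)).toMeasure {e} =
      if e ∈ (hG x).1.toFinset then ((hG x).1.toFinset.card : ℝ≥0∞)⁻¹ else 0 := by
    intro e
    rw [PMF.toMeasure_apply_singleton _ _ (measurableSet_singleton _), PMF.uniformOfFinset_apply]
  rw [tsum_eq_sum (s := (hG x).1.toFinset)]
  · rw [ENNReal.div_eq_inv_mul, Finset.mul_sum]
    refine Finset.sum_congr rfl fun e he => ?_
    rw [h1, if_pos he, mul_comm]
  · intro e he
    rw [h1, if_neg he, mul_zero]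

theorem lintegral_walkLaw_zero (g : V → ℝ≥0∞) (x : V) :
    ∫⁻ X, g (X 0) ∂(G.walkLaw hG hne x) = g x := by
  rw [walkLaw, Kernel.lintegral_traj]
  · simp [Function.updateFinset]
  · exact (Measurable.of_discrete (f := g)).comp (measurable_pi_apply 0)

/-- The Markov property of the random walk at time `m`. -/
theorem lintegral_walkLaw_succ (x : V) (m : ℕ) (f : ((i : Finset.Iic m) → V) → ℝ≥0∞)
    (g : V → ℝ≥0∞) :
    ∫⁻ X, f (Preorder.frestrictLe m X) * g (X (m + 1)) ∂(G.walkLaw hG hne x) =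
      ∫⁻ X, f (Preorder.frestrictLe m X) * ∫⁻ z, g z ∂(G.stepKernel hG hne (X m))
        ∂(G.walkLaw hG hne x) := by
  have hf : Measurable f := .of_discrete
  have hg : Measurable g := .of_discrete
  have hPg : Measurable fun y => ∫⁻ z, g z ∂(G.stepKernel hG hne y) := .of_discrete
  have hr : Measurable (Preorder.frestrictLe (π := fun _ => V) m) := by fun_prop
  rw [walkLaw, ← Kernel.traj_comp_partialTraj (Nat.zero_le m), Kernel.comp_apply,
    Measure.lintegral_bind (Kernel.aemeasurable _) (by fun_prop),
    Measure.lintegral_bind (Kernel.aemeasurable _) (by fun_prop)]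
  refine lintegral_congr fun h => ?_
  have hu : ∀ X : ℕ → V,
      Preorder.frestrictLe m (Function.updateFinset X (Finset.Iic m) h) = h := by
    intro X; ext i
    simp [Function.updateFinset]
  rw [Kernel.lintegral_traj _ (by fun_prop)]
  conv_rhs => rw [Kernel.lintegral_traj _ (by fun_prop)]
  simp only [hu]
  have h1 : ∀ X : ℕ → V, Function.updateFinset X (Finset.Iic m) h (m + 1) = X (m + 1) := by
    intro X; simp [Function.updateFinset]
  have h2 : ∀ X : ℕ → V, Function.updateFinset X (Finset.Iic m) h m =
      h ⟨m, Finset.mem_Iic.2 le_rfl⟩ := by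
    intro X; simp [Function.updateFinset]
  simp only [h1, h2]
  rw [lintegral_const_mul _ (by fun_prop), lintegral_const, measure_univ, mul_one]
  congr 1
  rw [← lintegral_map (g := fun X : ℕ → V => X (m + 1)) hg (by fun_prop),
    ← Kernel.map_apply _ (by fun_prop), Kernel.map_traj_succ_self]
  rfl

theorem lintegral_stepKernel_killedProb [Countable E] (y : V) (n : ℕ) (x : V) :
    ∫⁻ z, ENNReal.ofReal (G.killedProb hG Set.univ y n z) ∂(G.stepKernel hG hne x) =
      ENNReal.ofReal (G.killedProb hG Set.univ y (n + 1) x) := by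
  have hcard : 0 < ((hG x).1.toFinset.card : ℝ) := by
    have := (hne x)
    simpa [Finset.card_pos] using this
  rw [lintegral_stepKernel, killedProb, if_pos (Set.mem_univ x), ENNReal.ofReal_div_of_pos hcard,
    ENNReal.ofReal_sum_of_nonneg fun e _ => G.killedProb_nonneg hG _ _ _ _, ENNReal.ofReal_natCast]

/-- The Markov property of the random walk over several steps. -/
theorem lintegral_walkLaw_add [Countable E] (x y : V) (m k j : ℕ)
    (f : ((i : Finset.Iic m) → V) → ℝ≥0∞) :
    ∫⁻ X, f (Preorder.frestrictLe m X) *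
        ENNReal.ofReal (G.killedProb hG Set.univ y j (X (m + k))) ∂(G.walkLaw hG hne x) =
      ∫⁻ X, f (Preorder.frestrictLe m X) *
        ENNReal.ofReal (G.killedProb hG Set.univ y (j + k) (X m)) ∂(G.walkLaw hG hne x) := by
  induction k generalizing j with
  | zero => rfl
  | succ k ih =>
    have := G.lintegral_walkLaw_succ hG hne x (m + k)
      (fun h => f (Preorder.frestrictLe₂ (π := fun _ => V) (Nat.le_add_right m k) h))
      (fun z => ENNReal.ofReal (G.killedProb hG Set.univ y j z))
    simp only [lintegral_stepKernel_killedProb] at this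
    rw [show j + (k + 1) = (j + 1) + k by ring, ← ih]
    exact this

open scoped Classical in
theorem ofReal_killedProb_eq [Countable E] (x y : V) (n : ℕ) :
    ENNReal.ofReal (G.killedProb hG Set.univ y n x) =
      ∫⁻ X, (if X n = y then 1 else 0) ∂(G.walkLaw hG hne x) := by
  have := G.lintegral_walkLaw_add hG hne x y 0 n 0 (fun _ => 1)
  simp only [one_mul, zero_add, ofReal_killedProb_zero] at this
  rw [this, G.lintegral_walkLaw_zero hG hne
    (fun z => ENNReal.ofReal (G.killedProb hG Set.univ y n z))]

open scoped Classical in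
theorem lintegral_firstVisit_mul [Countable E] (x y : V) (N m k : ℕ) :
    ∫⁻ X, (firstVisit y N m).indicator 1 X * (if X (N + m + k) = y then 1 else 0)
      ∂(G.walkLaw hG hne x) =
    G.walkLaw hG hne x (firstVisit y N m) * ENNReal.ofReal (G.killedProb hG Set.univ y k y) := by
  let f : ((i : Finset.Iic (N + m)) → V) → ℝ≥0∞ := fun h =>
    if h ⟨N + m, Finset.mem_Iic.2 le_rfl⟩ = y ∧
      ∀ j (hj : j < m), h ⟨N + j, Finset.mem_Iic.2 (by omega)⟩ ≠ y then 1 else 0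
  have hf : ∀ X : ℕ → V,
      (firstVisit y N m).indicator 1 X = f (Preorder.frestrictLe (N + m) X) := by
    intro X
    simp only [Set.indicator_apply, f, firstVisit, Set.mem_ofPred_eq, Preorder.frestrictLe_apply,
      Pi.one_apply]
    congr
  have := G.lintegral_walkLaw_add hG hne x y (N + m) k 0 f
  simp only [ofReal_killedProb_zero, zero_add, ← hf] at this
  rw [this, mul_comm, ← lintegral_indicator_one (measurableSet_firstVisit y N m),
    ← lintegral_const_mul _ (measurable_one.indicator (measurableSet_firstVisit y N m))]
  refine lintegral_congr fun X => ?_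
  by_cases hX : X ∈ firstVisit y N m
  · have h1 : X (N + m) = y := hX.1
    rw [h1, mul_comm]
  · simp [hX]

/-- The expected number of visits to `y` in a time window starting at `N` is at most the probability
of visiting `y` after time `N` times the expected number of visits of the walk started at `y`. -/
theorem sum_killedProb_le [Countable E] (x y : V) (N M : ℕ) :
    ∑ n ∈ Finset.range M, ENNReal.ofReal (G.killedProb hG Set.univ y (N + n) x) ≤
      G.walkLaw hG hne x {X | ∃ n, X (N + n) = y} *
        ∑ k ∈ Finset.range M, ENNReal.ofReal (G.killedProb hG Set.univ y k y) := by
  classical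
  have hmeas : ∀ n, Measurable fun X : ℕ → V => if X n = y then (1 : ℝ≥0∞) else 0 := fun n =>
    (Measurable.of_discrete (f := fun z => if z = y then (1 : ℝ≥0∞) else 0)).comp
      (measurable_pi_apply n)
  have hind : ∀ m, Measurable ((firstVisit y N m).indicator (1 : (ℕ → V) → ℝ≥0∞)) := fun m =>
    measurable_one.indicator (measurableSet_firstVisit y N m)
  have hprod : ∀ m k, Measurable fun X : ℕ → V =>
      (firstVisit y N m).indicator (1 : (ℕ → V) → ℝ≥0∞) X * if X (N + m + k) = y then 1 else 0 :=
    fun m k => (hind m).mul (hmeas _)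
  calc ∑ n ∈ Finset.range M, ENNReal.ofReal (G.killedProb hG Set.univ y (N + n) x)
      = ∫⁻ X, ∑ n ∈ Finset.range M, (if X (N + n) = y then (1 : ℝ≥0∞) else 0)
          ∂(G.walkLaw hG hne x) := by
        rw [lintegral_finsetSum _ fun n _ => hmeas _]
        exact Finset.sum_congr rfl fun n _ => G.ofReal_killedProb_eq hG hne x y _
    _ ≤ ∫⁻ X, ∑ m ∈ Finset.range M, ∑ k ∈ Finset.range M,
          (firstVisit y N m).indicator 1 X * (if X (N + m + k) = y then 1 else 0)
          ∂(G.walkLaw hG hne x) := lintegral_mono fun X => sum_visits_le y N M X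
    _ = ∑ m ∈ Finset.range M, ∑ k ∈ Finset.range M, G.walkLaw hG hne x (firstVisit y N m) *
          ENNReal.ofReal (G.killedProb hG Set.univ y k y) := by
        rw [lintegral_finsetSum _ fun m _ =>
          Finset.measurable_fun_sum _ fun k _ => hprod m k]
        refine Finset.sum_congr rfl fun m _ => ?_
        rw [lintegral_finsetSum _ fun k _ => hprod m k]
        exact Finset.sum_congr rfl fun k _ => G.lintegral_firstVisit_mul hG hne x y N m k
    _ = (∑ m ∈ Finset.range M, G.walkLaw hG hne x (firstVisit y N m)) *
          ∑ k ∈ Finset.range M, ENNReal.ofReal (G.killedProb hG Set.univ y k y) := by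
        rw [Finset.sum_mul_sum]
    _ ≤ _ := by
        gcongr
        rw [← measure_biUnion_finset]
        · refine measure_mono ?_
          intro X hX
          simp only [Set.mem_iUnion] at hX
          obtain ⟨m, -, hm⟩ := hX
          exact ⟨m, hm.1⟩
        · intro a _ b _ hab
          refine Set.disjoint_left.2 fun X ha hb => ?_
          rcases lt_or_gt_of_ne hab with h | h
          · exact hb.2 a h ha.1
          · exact ha.2 b h hb.1
        · exact fun m _ => measurableSet_firstVisit y N m

/-- If the walk almost surely visits each vertex finitely often, the expected numbers of visits are
finite. -/
theorem summable_killedProb_of_finite_visits [Countable E]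
    (h : ∀ x, ∀ᵐ X ∂(G.walkLaw hG hne x), ∀ y, {n | X n = y}.Finite) (x y : V) :
    Summable fun n => G.killedProb hG Set.univ y n x := by
  have hlim : Tendsto (fun N => G.walkLaw hG hne y {X | ∃ n, X (N + n) = y}) atTop (𝓝 0) := by
    have h0 : G.walkLaw hG hne y (⋂ N, {X | ∃ n, X (N + n) = y}) = 0 := by
      refine measure_mono_null ?_ (h y)
      intro X hX hfin
      obtain ⟨B, hB⟩ := (hfin y).bddAbove
      obtain ⟨n, hn⟩ := Set.mem_iInter.1 hX (B + 1)
      have : B + 1 + n ≤ B := hB hn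
      omega
    rw [← h0]
    refine tendsto_measure_iInter_atTop (fun N => ?_) (fun a b hab X hX => ?_)
      ⟨0, measure_ne_top _ _⟩
    · have : {X : ℕ → V | ∃ n, X (N + n) = y} = ⋃ n, {X | X (N + n) = y} := by ext; simp
      rw [this]
      exact (MeasurableSet.iUnion fun n => measurableSet_visit y (N + n)).nullMeasurableSet
    · obtain ⟨n, hn⟩ := hX
      exact ⟨b - a + n, by rw [← hn]; congr 1; omega⟩
  obtain ⟨N, hN⟩ := (hlim.eventually (gt_mem_nhds (by norm_num : (0 : ℝ≥0∞) < 2⁻¹))).exists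
  have hle1 : ∀ n z, ENNReal.ofReal (G.killedProb hG Set.univ y n z) ≤ 1 := fun n z =>
    ENNReal.ofReal_le_one.2 (G.killedProb_le_one hG hne y n z)
  -- At most half of the expected number `U` of visits in a long window comes from times after `N`.
  have hU : ∀ M, ∑ k ∈ Finset.range M, ENNReal.ofReal (G.killedProb hG Set.univ y k y) ≤ 2 * N := by
    intro M
    set U := ∑ k ∈ Finset.range M, ENNReal.ofReal (G.killedProb hG Set.univ y k y) with hUdef
    have hUtop : U ≠ ⊤ := ENNReal.sum_ne_top.2 fun k _ => ENNReal.ofReal_ne_top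
    have h1 : U ≤ N + 2⁻¹ * U := by
      calc U ≤ ∑ k ∈ Finset.range (N + M),
            ENNReal.ofReal (G.killedProb hG Set.univ y k y) :=
            Finset.sum_le_sum_of_subset (Finset.range_mono (Nat.le_add_left _ _))
        _ = ∑ k ∈ Finset.range N, ENNReal.ofReal (G.killedProb hG Set.univ y k y) +
            ∑ k ∈ Finset.range M, ENNReal.ofReal (G.killedProb hG Set.univ y (N + k) y) :=
            Finset.sum_range_add _ _ _
        _ ≤ N + 2⁻¹ * U := by
            gcongr
            · simpa using Finset.sum_le_sum fun k (_ : k ∈ Finset.range N) => hle1 k y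
            · exact (G.sum_killedProb_le hG hne y y N M).trans (by gcongr)
    clear_value U
    lift U to NNReal using hUtop
    have h2 : (U : ℝ≥0∞) ≤ ((N + 2⁻¹ * U : NNReal) : ℝ≥0∞) := by
      simpa [ENNReal.coe_inv] using h1
    have h3 : (U : ℝ) ≤ N + 2⁻¹ * U := by exact_mod_cast h2
    have h4 : (U : ℝ) ≤ 2 * N := by linarith
    exact_mod_cast h4
  refine summable_of_sum_range_le (c := 2 * N) (fun n => G.killedProb_nonneg hG _ _ _ _) fun M => ?_
  have h1 : ∑ n ∈ Finset.range M, ENNReal.ofReal (G.killedProb hG Set.univ y n x) ≤ 2 * N := by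
    have := G.sum_killedProb_le hG hne x y 0 M
    simp only [zero_add] at this
    exact this.trans ((mul_le_mul_left prob_le_one _).trans ((one_mul _).le.trans (hU M)))
  rw [← ENNReal.ofReal_sum_of_nonneg fun n _ => G.killedProb_nonneg hG _ _ _ _] at h1
  have h2 := ENNReal.toReal_mono (by finiteness) h1
  rwa [ENNReal.toReal_ofReal (Finset.sum_nonneg fun n _ => G.killedProb_nonneg hG _ _ _ _),
    ENNReal.toReal_mul, ENNReal.toReal_natCast, ENNReal.toReal_ofNat] at h2

end WalkGreen

/-- On a transient digraph the Green function is finite. -/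
theorem IsTransient.summable_killedProb {V E : Type*} [Countable V] [Countable E]
    {G : MultiDigraph V E} {hG : G.LocallyFinite} (h : G.IsTransient hG) (x y : V) :
    Summable fun n => G.killedProb hG Set.univ y n x := by
  obtain ⟨hne, h⟩ := h
  let _ : MeasurableSpace V := ⊤
  have : MeasurableSingletonClass V := ⟨fun _ => trivial⟩
  exact G.summable_killedProb_of_finite_visits hG hne h x y

end MultiDigraph

/-! ### The past interior of a finite set of vertices -/

namespace MultiDigraph

section PastInterior

variable {V E : Type*}

/-- The vertices whose past in `A` is contained in `Λ`. -/
def pastInterior (G : MultiDigraph V E) (A : Set E) (Λ : Set V) : Set V :=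
  {x | G.past A x ⊆ Λ}

theorem pastInterior_subset (G : MultiDigraph V E) (A : Set E) (Λ : Set V) :
    G.pastInterior A Λ ⊆ Λ := fun _ hx => hx .refl

theorem tail_mem_pastInterior (G : MultiDigraph V E) {A : Set E} {Λ : Set V} {e : E} (he : e ∈ A)
    (h : G.head e ∈ G.pastInterior A Λ) : G.tail e ∈ G.pastInterior A Λ :=
  fun _ hx => h (Relation.ReflTransGen.tail hx ⟨e, he, rfl, rfl⟩)

theorem past_subset_of_incidentEdges (G : MultiDigraph V E) {A A' : Set E} {Λ : Set V}
    (h : ∀ e ∈ G.incidentEdges Λ, e ∈ A' → e ∈ A) {x : V} (hx : G.past A x ⊆ Λ) :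
    G.past A' x ⊆ G.past A x := by
  intro y hy
  induction hy using Relation.ReflTransGen.head_induction_on with
  | refl => exact .refl
  | head hab _ ih =>
    obtain ⟨e, he, h1, h2⟩ := hab
    exact .head ⟨e, h e (Or.inr (h2 ▸ hx ih)) he, h1, h2⟩ ih

/-- The past interior of `Λ` only depends on the edges incident to `Λ`. -/
theorem pastInterior_congr (G : MultiDigraph V E) {A A' : Set E} {Λ : Set V}
    (h : ∀ e ∈ G.incidentEdges Λ, e ∈ A ↔ e ∈ A') :
    G.pastInterior A Λ = G.pastInterior A' Λ := by
  ext x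
  exact ⟨fun hx => (G.past_subset_of_incidentEdges (fun e he => (h e he).2) hx).trans hx,
    fun hx => (G.past_subset_of_incidentEdges (fun e he => (h e he).1) hx).trans hx⟩

/-- The past interior is a stopping set: the event that it equals `W` only depends on the edges
whose tails are outside `W`. -/
theorem pastInterior_eq_of_agree (G : MultiDigraph V E) {A A' : Set E} {Λ W : Set V}
    (hA : G.pastInterior A Λ = W) (h : ∀ e, G.tail e ∉ W → (e ∈ A ↔ e ∈ A')) :
    G.pastInterior A' Λ = W := by
  have hWΛ : W ⊆ Λ := hA ▸ G.pastInterior_subset A Λ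
  have hclosed : ∀ e ∈ A, G.head e ∈ W → G.tail e ∈ W := by
    intro e he h'
    rw [← hA] at h' ⊢
    exact G.tail_mem_pastInterior he h'
  ext x
  constructor
  · intro hx
    rw [← hA]
    intro y hy
    by_contra hyΛ
    -- A path in `A` that starts outside `Λ` avoids `W`, hence is a path in `A'`.
    have key : ∀ c, Relation.ReflTransGen (G.Step A) y c →
        Relation.ReflTransGen (G.Step A') y c := by
      intro c hc
      induction hc with
      | refl => exact .refl
      | tail hb hbc ih =>
        obtain ⟨e, he, rfl, rfl⟩ := hbc
        have ht : G.tail e ∉ W := by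
          rw [← hA]
          exact fun ht => hyΛ (ht hb)
        exact ih.tail ⟨e, (h e ht).1 he, rfl, rfl⟩
    exact hyΛ (hx (key x hy))
  · intro hx y hy
    have : y ∈ W := by
      induction hy using Relation.ReflTransGen.head_induction_on with
      | refl => exact hx
      | head hab _ ih =>
        obtain ⟨e, he, rfl, rfl⟩ := hab
        by_contra ht
        exact ht (hclosed e ((h e ht).2 he) ih)
    exact hWΛ this

/-! ### The domain Markov property for rooted forests -/

/-- Restricting a rooted forest to the edges out of the vertices of a subset. -/
theorem IsRootedForest.restrict {G : MultiDigraph V E} {U W : Set V} {A : Set E}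
    (hA : G.IsRootedForest U A) (hWU : W ⊆ U) :
    G.IsRootedForest W {e ∈ A | G.tail e ∈ W} := by
  refine ⟨fun e he => he.2, fun v hv => ?_, fun v => ?_⟩
  · obtain ⟨e, ⟨he, rfl⟩, huniq⟩ := hA.2.1 v (hWU hv)
    exact ⟨e, ⟨⟨he, hv⟩, rfl⟩, fun e' he' => huniq e' ⟨he'.1.1, he'.2⟩⟩
  · obtain ⟨u, hu, hvu⟩ := hA.2.2 v
    induction hvu using Relation.ReflTransGen.head_induction_on with
    | refl => exact ⟨u, fun h => hu (hWU h), .refl⟩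
    | @head a b hab _ ih =>
      by_cases ha : a ∈ W
      · obtain ⟨e, he, rfl, rfl⟩ := hab
        obtain ⟨u', hu', hp⟩ := ih
        exact ⟨u', hu', hp.head ⟨e, ⟨he, ha⟩, rfl, rfl⟩⟩
      · exact ⟨a, ha, .refl⟩

/-- If no edge of a rooted forest enters `W`, then replacing the part out of `W` by another rooted
forest of `W` yields a rooted forest. -/
theorem IsRootedForest.glue {G : MultiDigraph V E} {U W : Set V} {A C : Set E}
    (hA : G.IsRootedForest U A) (hC : G.IsRootedForest W C) (hWU : W ⊆ U)
    (hclosed : ∀ e ∈ A, G.head e ∈ W → G.tail e ∈ W) :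
    G.IsRootedForest U ({e ∈ A | G.tail e ∉ W} ∪ C) := by
  refine ⟨?_, fun v hv => ?_, fun v => ?_⟩
  · rintro e (he | he)
    · exact hA.1 e he.1
    · exact hWU (hC.1 e he)
  · by_cases hvW : v ∈ W
    · obtain ⟨e, ⟨he, rfl⟩, huniq⟩ := hC.2.1 v hvW
      refine ⟨e, ⟨Or.inr he, rfl⟩, ?_⟩
      rintro e' ⟨he' | he', h⟩
      · exact absurd (h ▸ hvW) he'.2
      · exact huniq e' ⟨he', h⟩
    · obtain ⟨e, ⟨he, rfl⟩, huniq⟩ := hA.2.1 v hv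
      refine ⟨e, ⟨Or.inl ⟨he, hvW⟩, rfl⟩, ?_⟩
      rintro e' ⟨he' | he', h⟩
      · exact huniq e' ⟨he'.1, h⟩
      · exact absurd (h ▸ hC.1 e' he') hvW
  · -- The path leaves `W` through `C` and then continues in `A` without returning to `W`.
    obtain ⟨w, hw, hvw⟩ := hC.2.2 v
    obtain ⟨u, hu, hwu⟩ := hA.2.2 w
    refine ⟨u, hu, ?_⟩
    have h1 : Relation.ReflTransGen (G.Step ({e ∈ A | G.tail e ∉ W} ∪ C)) v w :=
      Relation.ReflTransGen.mono (fun _ _ ⟨e, he, h⟩ => ⟨e, Or.inr he, h⟩) _ _ hvw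
    have h2 : ∀ c, Relation.ReflTransGen (G.Step A) w c → c ∉ W ∧
        Relation.ReflTransGen (G.Step ({e ∈ A | G.tail e ∉ W} ∪ C)) w c := by
      intro c hc
      induction hc with
      | refl => exact ⟨hw, .refl⟩
      | tail _ hbc ih =>
        obtain ⟨e, he, rfl, rfl⟩ := hbc
        exact ⟨fun h => ih.1 (hclosed e he h), ih.2.tail ⟨e, Or.inl ⟨he, ih.1⟩, rfl, rfl⟩⟩
    exact h1.trans (h2 u hwu).2

/-- The domain Markov property: given that the past interior of `Λ` is `W`, the part of the uniform
rooted forest out of `W` is a uniform rooted forest of `W`. The two sides count the same pairs of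
forests, up to swapping their parts out of `W`. -/
theorem ncard_mul_ncard_isRootedForest [Finite E] (G : MultiDigraph V E) {U W Λ : Set V}
    (hWU : W ⊆ U) {F : Set E} (hF : ∀ e ∈ F, G.tail e ∈ W) :
    {A | G.IsRootedForest U A ∧ G.pastInterior A Λ = W ∧ F ⊆ A}.ncard *
      {C | G.IsRootedForest W C}.ncard =
    {A | G.IsRootedForest U A ∧ G.pastInterior A Λ = W}.ncard *
      {C | G.IsRootedForest W C ∧ F ⊆ C}.ncard := by
  let σ : Set E × Set E → Set E × Set E := fun p =>
    ({e ∈ p.1 | G.tail e ∉ W} ∪ p.2, {e ∈ p.1 | G.tail e ∈ W})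
  have hσσ : ∀ p : Set E × Set E, G.IsRootedForest W p.2 → σ (σ p) = p := by
    rintro ⟨A, C⟩ hC
    have h := hC.1
    simp only at h
    refine Prod.ext ?_ ?_ <;> ext e <;>
      simp only [σ, Set.mem_union, Set.mem_ofPred_eq]
    · by_cases he : G.tail e ∈ W
      · simp [he]
      · simpa [he] using fun h' => absurd (h e h') he
    · constructor
      · rintro ⟨he | he, h'⟩
        · exact absurd h' he.2
        · exact he
      · exact fun he => ⟨Or.inr he, h e he⟩
  have hσ : ∀ p : Set E × Set E, G.IsRootedForest U p.1 → G.pastInterior p.1 Λ = W →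
      G.IsRootedForest W p.2 → G.IsRootedForest U (σ p).1 ∧ G.pastInterior (σ p).1 Λ = W ∧
        G.IsRootedForest W (σ p).2 := by
    rintro ⟨A, C⟩ hA hW hC
    refine ⟨hA.glue hC hWU fun e he h => ?_, G.pastInterior_eq_of_agree hW fun e he => ?_,
      hA.restrict hWU⟩
    · rw [← hW] at h ⊢
      exact G.tail_mem_pastInterior he h
    · have : e ∉ C := fun h => he (hC.1 e h)
      simp [σ, he, this]
  rw [← Set.ncard_prod, ← Set.ncard_prod]
  refine Set.ncard_congr (fun p _ => σ p) ?_ ?_ ?_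
  · rintro p ⟨⟨hA, hW, hFA⟩, hC⟩
    obtain ⟨h1, h2, h3⟩ := hσ p hA hW hC
    exact ⟨⟨h1, h2⟩, h3, fun e he => ⟨hFA he, hF e he⟩⟩
  · rintro p q ⟨-, hp⟩ ⟨-, hq⟩ hpq
    rw [← hσσ p hp, ← hσσ q hq, hpq]
  · rintro p ⟨⟨hA, hW⟩, hC, hFC⟩
    obtain ⟨h1, h2, h3⟩ := hσ p hA hW hC
    exact ⟨σ p, ⟨⟨h1, h2, fun e he => Or.inr (hFC he)⟩, h3⟩, hσσ p hC⟩

end PastInterior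

/-! ### Transport along partial isomorphisms -/

section Transport

variable {V₁ E₁ V₂ E₂ : Type*} {G₁ : MultiDigraph V₁ E₁} {G₂ : MultiDigraph V₂ E₂}

namespace PartialIso

/-- The inverse of a partial isomorphism. -/
def symm (Φ : PartialIso G₁ G₂) : PartialIso G₂ G₁ where
  vert := Φ.vert.symm
  edge := Φ.edge.symm
  tail_mem _ _ h := Φ.vert.mem_iff_mem.2 (Φ.tail_mem _ _ (Φ.edge.mem_iff_mem.1 h))
  head_mem _ _ h := Φ.vert.mem_iff_mem.2 (Φ.head_mem _ _ (Φ.edge.mem_iff_mem.1 h))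

/-- `Φ` maps `W₁` onto `W₂` and the edges out of `W₁` onto the edges out of `W₂`. -/
structure MapsOutEdges (Φ : PartialIso G₁ G₂) (W₁ : Set V₁) (W₂ : Set V₂) : Prop where
  vert_mem : ∀ u ∈ W₁, ∃ w ∈ W₂, w ∈ Φ.vert u
  vert_mem' : ∀ w ∈ W₂, ∃ u ∈ W₁, w ∈ Φ.vert u
  edge_mem : ∀ e, G₁.tail e ∈ W₁ → ∃ e', e' ∈ Φ.edge e
  edge_mem' : ∀ e', G₂.tail e' ∈ W₂ → ∃ e, e' ∈ Φ.edge e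

namespace MapsOutEdges

variable {Φ : PartialIso G₁ G₂} {W₁ : Set V₁} {W₂ : Set V₂}

theorem symm (h : Φ.MapsOutEdges W₁ W₂) : Φ.symm.MapsOutEdges W₂ W₁ where
  vert_mem w hw := (h.vert_mem' w hw).imp fun _ h => ⟨h.1, Φ.vert.mem_iff_mem.2 h.2⟩
  vert_mem' u hu := (h.vert_mem u hu).imp fun _ h => ⟨h.1, Φ.vert.mem_iff_mem.2 h.2⟩
  edge_mem e he := (h.edge_mem' e he).imp fun _ h => Φ.edge.mem_iff_mem.2 h
  edge_mem' e he := (h.edge_mem e he).imp fun _ h => Φ.edge.mem_iff_mem.2 h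

theorem mem_iff (h : Φ.MapsOutEdges W₁ W₂) {u : V₁} {w : V₂} (huw : w ∈ Φ.vert u) :
    u ∈ W₁ ↔ w ∈ W₂ := by
  constructor
  · intro hu
    obtain ⟨w', hw', h'⟩ := h.vert_mem u hu
    rwa [Option.mem_unique huw h']
  · intro hw
    obtain ⟨u', hu', h'⟩ := h.vert_mem' w hw
    rwa [Φ.vert.inj huw h']

theorem isRootedForest (h : Φ.MapsOutEdges W₁ W₂) {C : Set E₁} (hC : G₁.IsRootedForest W₁ C) :
    G₂.IsRootedForest W₂ (Φ.edgeImage C) := by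
  refine ⟨?_, fun w hw => ?_, fun w => ?_⟩
  · rintro e' ⟨e, he, hee⟩
    exact (h.mem_iff (Φ.tail_mem _ _ hee)).1 (hC.1 e he)
  · obtain ⟨u, hu, huw⟩ := h.vert_mem' w hw
    obtain ⟨e, ⟨he, rfl⟩, huniq⟩ := hC.2.1 u hu
    obtain ⟨e', hee⟩ := h.edge_mem e hu
    refine ⟨e', ⟨⟨e, he, hee⟩, Option.mem_unique (Φ.tail_mem _ _ hee) huw⟩, ?_⟩
    rintro e'' ⟨⟨e₁, he₁, hee₁⟩, rfl⟩
    have := huniq e₁ ⟨he₁, Φ.vert.inj (Φ.tail_mem _ _ hee₁) huw⟩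
    subst this
    exact Option.mem_unique hee₁ hee
  · by_cases hw : w ∈ W₂
    · obtain ⟨v, hv, hvw⟩ := h.vert_mem' w hw
      obtain ⟨u, hu, hvu⟩ := hC.2.2 v
      clear hv hw
      induction hvu using Relation.ReflTransGen.head_induction_on generalizing w with
      | refl => exact ⟨w, fun hw => hu ((h.mem_iff hvw).2 hw), .refl⟩
      | head hab _ ih =>
        obtain ⟨e, he, rfl, rfl⟩ := hab
        obtain ⟨e', hee⟩ := h.edge_mem e (hC.1 e he)
        obtain ⟨w', hw', hp⟩ := ih _ (Φ.head_mem _ _ hee)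
        exact ⟨w', hw', hp.head ⟨e', ⟨e, he, hee⟩,
          Option.mem_unique (Φ.tail_mem _ _ hee) hvw, rfl⟩⟩
    · exact ⟨w, hw, .refl⟩

theorem edgeImage_symm_edgeImage (h : Φ.MapsOutEdges W₁ W₂) {C : Set E₁}
    (hC : ∀ e ∈ C, G₁.tail e ∈ W₁) : Φ.symm.edgeImage (Φ.edgeImage C) = C := by
  ext e
  constructor
  · rintro ⟨e', ⟨e₁, he₁, h1⟩, h2⟩
    rwa [Φ.edge.inj (Φ.edge.mem_iff_mem.1 h2) h1]
  · intro he
    obtain ⟨e', hee⟩ := h.edge_mem e (hC e he)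
    exact ⟨e', ⟨e, he, hee⟩, Φ.edge.mem_iff_mem.2 hee⟩

theorem edgeImage_symm_subset_iff (h : Φ.MapsOutEdges W₁ W₂) {F : Set E₂}
    (hF : ∀ e ∈ F, G₂.tail e ∈ W₂) (A : Set E₁) :
    Φ.symm.edgeImage F ⊆ A ↔ F ⊆ Φ.edgeImage A := by
  constructor
  · intro hFA e' he'
    obtain ⟨e, hee⟩ := h.edge_mem' e' (hF e' he')
    exact ⟨e, hFA ⟨e', he', Φ.edge.mem_iff_mem.2 hee⟩, hee⟩
  · rintro hFA e ⟨e', he', hee⟩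
    obtain ⟨e₁, he₁, h1⟩ := hFA he'
    rwa [Φ.edge.inj (Φ.edge.mem_iff_mem.1 hee) h1]

theorem ncard_isRootedForest (h : Φ.MapsOutEdges W₁ W₂) {F : Set E₂}
    (hF : ∀ e ∈ F, G₂.tail e ∈ W₂) :
    {C | G₁.IsRootedForest W₁ C ∧ Φ.symm.edgeImage F ⊆ C}.ncard =
      {B | G₂.IsRootedForest W₂ B ∧ F ⊆ B}.ncard := by
  refine Set.ncard_congr (fun C _ => Φ.edgeImage C) ?_ ?_ ?_
  · rintro C ⟨hC, hFC⟩
    exact ⟨h.isRootedForest hC, (h.edgeImage_symm_subset_iff hF C).1 hFC⟩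
  · rintro C D ⟨hC, -⟩ ⟨hD, -⟩ hCD
    rw [← h.edgeImage_symm_edgeImage hC.1, ← h.edgeImage_symm_edgeImage hD.1, hCD]
  · rintro B ⟨hB, hFB⟩
    refine ⟨Φ.symm.edgeImage B, ⟨h.symm.isRootedForest hB, ?_⟩,
      h.symm.edgeImage_symm_edgeImage hB.1⟩
    rintro e ⟨e', he', hee⟩
    exact ⟨e', hFB he', hee⟩

end MapsOutEdges

/-- `Φ` is defined at all edges incident to a set, and maps them onto the edges incident to the
image `Λ` of this set. -/
structure IdentifiesNear (Φ : PartialIso G₁ G₂) (Λ : Set V₂) : Prop where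
  vert_mem : ∀ w ∈ Λ, ∃ u, w ∈ Φ.vert u
  bijOn : Set.BijOn Φ.edge (G₁.incidentEdges (Φ.vertPreimage Λ)) (some '' G₂.incidentEdges Λ)

namespace IdentifiesNear

variable {Φ : PartialIso G₁ G₂} {Λ W : Set V₂}

theorem mem_vertPreimage_iff {u : V₁} {w : V₂} (huw : w ∈ Φ.vert u) :
    u ∈ Φ.vertPreimage W ↔ w ∈ W := by
  constructor
  · rintro ⟨w', hw', h'⟩
    rwa [Option.mem_unique huw h']
  · exact fun hw => ⟨w, hw, huw⟩

theorem exists_edge (h : Φ.IdentifiesNear Λ) {e : E₁}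
    (he : e ∈ G₁.incidentEdges (Φ.vertPreimage Λ)) : ∃ e', e' ∈ Φ.edge e := by
  obtain ⟨e', -, hee⟩ := h.bijOn.mapsTo he
  exact ⟨e', hee.symm⟩

theorem mapsOutEdges (h : Φ.IdentifiesNear Λ) (hW : W ⊆ Λ) :
    Φ.MapsOutEdges (Φ.vertPreimage W) W where
  vert_mem _ hu := hu
  vert_mem' w hw := (h.vert_mem w (hW hw)).imp fun _ hu => ⟨⟨w, hw, hu⟩, hu⟩
  edge_mem e := by
    rintro ⟨w, hw, hww⟩
    exact h.exists_edge (Or.inl ⟨w, hW hw, hww⟩)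
  edge_mem' e' he' := by
    obtain ⟨e, -, hee⟩ := h.bijOn.surjOn ⟨e', Or.inl (hW he'), rfl⟩
    exact ⟨e, hee⟩

theorem past_subset_iff (h : Φ.IdentifiesNear Λ) (A : Set E₁) {u : V₁} {w : V₂}
    (huw : w ∈ Φ.vert u) :
    G₂.past (Φ.edgeImage A) w ⊆ Λ ↔ G₁.past A u ⊆ Φ.vertPreimage Λ := by
  constructor
  · intro hp
    have key : ∀ y, Relation.ReflTransGen (G₁.Step A) y u →
        ∃ y' ∈ Φ.vert y, Relation.ReflTransGen (G₂.Step (Φ.edgeImage A)) y' w := by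
      intro y hy
      induction hy using Relation.ReflTransGen.head_induction_on with
      | refl => exact ⟨w, huw, .refl⟩
      | head hab _ ih =>
        obtain ⟨e, he, rfl, rfl⟩ := hab
        obtain ⟨b', hb', hbw⟩ := ih
        obtain ⟨e', hee⟩ := h.exists_edge (e := e) (Or.inr ⟨b', hp hbw, hb'⟩)
        exact ⟨G₂.tail e', Φ.tail_mem _ _ hee, hbw.head ⟨e', ⟨e, he, hee⟩, rfl,
          Option.mem_unique (Φ.head_mem _ _ hee) hb'⟩⟩
    intro y hy
    obtain ⟨y', hy', hyw⟩ := key y hy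
    exact ⟨y', hp hyw, hy'⟩
  · intro hp
    have key : ∀ y, Relation.ReflTransGen (G₂.Step (Φ.edgeImage A)) y w →
        ∃ x, y ∈ Φ.vert x ∧ Relation.ReflTransGen (G₁.Step A) x u := by
      intro y hy
      induction hy using Relation.ReflTransGen.head_induction_on with
      | refl => exact ⟨u, huw, .refl⟩
      | head hab _ ih =>
        obtain ⟨e', ⟨e, he, hee⟩, rfl, rfl⟩ := hab
        obtain ⟨x, hx, hxu⟩ := ih
        exact ⟨G₁.tail e, Φ.tail_mem _ _ hee, hxu.head ⟨e, he, rfl,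
          Φ.vert.inj (Φ.head_mem _ _ hee) hx⟩⟩
    intro y hy
    obtain ⟨x, hx, hxu⟩ := key y hy
    exact (mem_vertPreimage_iff hx).1 (hp hxu)

theorem pastInterior_eq_iff (h : Φ.IdentifiesNear Λ) (hW : W ⊆ Λ) (A : Set E₁) :
    G₂.pastInterior (Φ.edgeImage A) Λ = W ↔
      G₁.pastInterior A (Φ.vertPreimage Λ) = Φ.vertPreimage W := by
  have key : ∀ u w, w ∈ Φ.vert u → w ∈ Λ → (w ∈ G₂.pastInterior (Φ.edgeImage A) Λ ↔
      u ∈ G₁.pastInterior A (Φ.vertPreimage Λ)) := fun u w huw _ => h.past_subset_iff A huw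
  constructor
  · intro hA
    ext u
    constructor
    · intro hu
      obtain ⟨w, hw, huw⟩ := G₁.pastInterior_subset _ _ hu
      rw [mem_vertPreimage_iff huw, ← hA]
      exact (key u w huw hw).2 hu
    · rintro ⟨w, hw, huw⟩
      exact (key u w huw (hW hw)).1 (hA ▸ hw)
  · intro hA
    ext w
    constructor
    · intro hw
      have hwΛ := G₂.pastInterior_subset _ _ hw
      obtain ⟨u, huw⟩ := h.vert_mem w hwΛ
      rw [← mem_vertPreimage_iff huw, ← hA]
      exact (key u w huw hwΛ).1 hw
    · intro hw
      obtain ⟨u, huw⟩ := h.vert_mem w (hW hw)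
      rw [key u w huw (hW hw), hA]
      exact ⟨w, hw, huw⟩

end IdentifiesNear

end PartialIso

end Transport

/-! ### Wired digraphs -/

section Wired

variable {V E : Type*}

open scoped Classical in
/-- The image of a vertex of `G` in a wired digraph. -/
noncomputable def wiredVertex (W : Finset V) (v : V) : Option W :=
  if h : v ∈ W then some ⟨v, h⟩ else none

theorem wiredVertex_eq_none_iff {W : Finset V} {v : V} : wiredVertex W v = none ↔ v ∉ W := by
  unfold wiredVertex; split_ifs <;> simp_all

theorem wiredVertex_eq_some_iff {W : Finset V} {v : V} {w : W} :
    wiredVertex W v = some w ↔ v = w := by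
  unfold wiredVertex
  split_ifs with h
  · simp [Subtype.ext_iff]
  · simp only [false_iff]
    rintro rfl
    exact h w.2

theorem wired_isSpanningInArborescence_iff (G : MultiDigraph V E) (W : Finset V)
    (A : Set (G.incidentEdges (W : Set V))) :
    (G.wired W).IsSpanningInArborescence none A ↔ G.IsRootedForest W (Subtype.val '' A) := by
  have htail : ∀ e, (G.wired W).tail e = wiredVertex W (G.tail e) := fun _ => rfl
  have hhead : ∀ e, (G.wired W).head e = wiredVertex W (G.head e) := fun _ => rfl
  constructor
  · rintro ⟨h1, h2, h3⟩
    have h2' : ∀ e ∈ A, G.tail e ∈ W := by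
      intro e he
      have := h2 e he
      rw [htail, Ne, wiredVertex_eq_none_iff, not_not] at this
      exact this
    refine ⟨?_, fun v hv => ?_, fun v => ?_⟩
    · rintro _ ⟨e, he, rfl⟩
      exact h2' e he
    · obtain ⟨e, ⟨he, hev⟩, huniq⟩ := h1 (some ⟨v, hv⟩) (by simp)
      rw [htail, wiredVertex_eq_some_iff] at hev
      refine ⟨e, ⟨⟨e, he, rfl⟩, hev⟩, ?_⟩
      rintro _ ⟨⟨e', he', rfl⟩, rfl⟩
      rw [huniq e' ⟨he', by rw [htail, wiredVertex_eq_some_iff]⟩]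
    · have key : ∀ a, Relation.ReflTransGen ((G.wired W).Step A) a none → ∀ v,
          wiredVertex W v = a → ∃ u, u ∉ (W : Set V) ∧
            Relation.ReflTransGen (G.Step (Subtype.val '' A)) v u := by
        intro a ha
        induction ha using Relation.ReflTransGen.head_induction_on with
        | refl => exact fun v hv => ⟨v, wiredVertex_eq_none_iff.1 hv, .refl⟩
        | head hab _ ih =>
          obtain ⟨e, he, rfl, rfl⟩ := hab
          intro v hv
          rw [htail, (wiredVertex_eq_some_iff (w := ⟨_, h2' e he⟩)).2 rfl,
            wiredVertex_eq_some_iff] at hv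
          obtain ⟨u, hu, hp⟩ := ih (G.head e) rfl
          exact ⟨u, hu, hp.head ⟨e, ⟨e, he, rfl⟩, hv.symm, rfl⟩⟩
      exact key _ (h3 _) v rfl
  · rintro ⟨h1, h2, h3⟩
    refine ⟨?_, fun e he => ?_, fun a => ?_⟩
    · rintro (_ | ⟨v, hv⟩) h
      · exact absurd rfl h
      · obtain ⟨_, ⟨⟨e, he, rfl⟩, hev⟩, huniq⟩ := h2 v hv
        refine ⟨e, ⟨he, by rw [htail, wiredVertex_eq_some_iff, hev]⟩, ?_⟩
        rintro e' ⟨he', hev'⟩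
        rw [htail, wiredVertex_eq_some_iff] at hev'
        exact Subtype.ext (huniq e' ⟨⟨e', he', rfl⟩, hev'⟩)
    · rw [htail, Ne, wiredVertex_eq_none_iff, not_not]
      exact h1 e ⟨e, he, rfl⟩
    · have key : ∀ v u, u ∉ W → Relation.ReflTransGen (G.Step (Subtype.val '' A)) v u →
          Relation.ReflTransGen ((G.wired W).Step A) (wiredVertex W v) none := by
        intro v u hu hvu
        induction hvu using Relation.ReflTransGen.head_induction_on with
        | refl => rw [wiredVertex_eq_none_iff.2 hu]
        | head hab _ ih =>
          obtain ⟨_, ⟨e, he, rfl⟩, rfl, rfl⟩ := hab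
          exact ih.head ⟨e, he, htail e, hhead e⟩
      rcases a with _ | v
      · exact .refl
      · obtain ⟨u, hu, hp⟩ := h3 v
        have := key v u hu hp
        rwa [(wiredVertex_eq_some_iff (w := v)).2 rfl] at this

/-- A rooted forest of `W` only uses edges of the wired digraph. -/
theorem IsRootedForest.exists_image_eq {G : MultiDigraph V E} {W : Set V} {B : Set E}
    (hB : G.IsRootedForest W B) :
    ∃ A : Set (G.incidentEdges W), Subtype.val '' A = B :=
  ⟨Subtype.val ⁻¹' B, by
    rw [Subtype.image_preimage_coe, Set.inter_eq_right]
    exact fun e he => Or.inl (hB.1 e he)⟩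

end Wired

end MultiDigraph

/-! ### Measures on sets of edges -/

namespace EdgeConfig

variable {E : Type*}

@[simp]
theorem edges_ofSet (A : Set E) : (ofSet A).edges = A := by
  ext e; simp [edges, ofSet]

/-- An event that only depends on finitely many edges is clopen. -/
theorem isClopen_of_finite {T : Set E} (hT : T.Finite) {S : Set (EdgeConfig E)}
    (h : ∀ ω ω' : EdgeConfig E, (∀ e ∈ T, ω e = ω' e) → ω ∈ S → ω' ∈ S) : IsClopen S := by
  have := hT.to_subtype
  let r : EdgeConfig E → (T → Bool) := fun ω e => ω e
  have hr : Continuous r := by fun_prop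
  have hS : S = r ⁻¹' (r '' S) := by
    refine Set.Subset.antisymm (Set.subset_preimage_image r S) ?_
    rintro ω ⟨ω', hω', hr'⟩
    exact h ω' ω (fun e he => congrFun hr' ⟨e, he⟩) hω'
  rw [hS]
  exact (isClopen_discrete _).preimage hr

/-- The event that all edges of `F` are present. -/
def containing (F : Finset E) : Set (EdgeConfig E) := {ω | (F : Set E) ⊆ ω.edges}

theorem isClopen_containing (F : Finset E) : IsClopen (containing F) :=
  isClopen_of_finite F.finite_toSet fun _ _ h hω e he => (h e he).symm.trans (hω he)

theorem isPiSystem_containing : IsPiSystem (Set.range (containing (E := E))) := by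
  classical
  rintro _ ⟨F₁, rfl⟩ _ ⟨F₂, rfl⟩ -
  exact ⟨F₁ ∪ F₂, by ext ω; simp [containing, Set.union_subset_iff]⟩

theorem generateFrom_containing [Countable E] :
    MeasurableSpace.generateFrom (Set.range (containing (E := E))) =
      (inferInstance : MeasurableSpace (EdgeConfig E)) := by
  refine le_antisymm (MeasurableSpace.generateFrom_le ?_) ?_
  · rintro _ ⟨F, rfl⟩
    exact (isClopen_containing F).isOpen.measurableSet
  · refine iSup_le fun e => ?_
    rw [← measurable_iff_comap_le]
    refine measurable_to_bool ?_
    refine MeasurableSpace.measurableSet_generateFrom ⟨{e}, ?_⟩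
    ext ω
    simp [containing, edges]

/-- A probability measure on sets of edges is determined by the probabilities that finite sets of
edges are present. -/
theorem probabilityMeasure_ext [Countable E] {μ₁ μ₂ : ProbabilityMeasure (EdgeConfig E)}
    (h : ∀ F, (μ₁ : Measure (EdgeConfig E)).real (containing F) =
      (μ₂ : Measure (EdgeConfig E)).real (containing F)) : μ₁ = μ₂ := by
  have : (μ₁ : Measure (EdgeConfig E)) = μ₂ := by
    refine ext_of_generate_finite _ generateFrom_containing.symm isPiSystem_containing ?_ (by simp)
    rintro _ ⟨F, rfl⟩
    exact (measureReal_eq_measureReal_iff).1 (h F)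
  exact Subtype.ext this

theorem tendsto_real_of_isClopen {ι : Type*} {l : Filter ι} [Countable E]
    {μs : ι → ProbabilityMeasure (EdgeConfig E)} {μ : ProbabilityMeasure (EdgeConfig E)}
    (h : Tendsto μs l (𝓝 μ)) {S : Set (EdgeConfig E)} (hS : IsClopen S) :
    Tendsto (fun i => (μs i : Measure (EdgeConfig E)).real S) l
      (𝓝 ((μ : Measure (EdgeConfig E)).real S)) := by
  have := ProbabilityMeasure.tendsto_measure_of_isClopen_of_tendsto h hS
  exact (NNReal.continuous_coe.tendsto _).comp this

/-- Weak convergence follows from convergence of the probabilities that finite sets of edges are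
present, by compactness of the space of probability measures. -/
theorem tendsto_of_tendsto_containing [Countable E] {ι : Type*} {l : Filter ι}
    {μs : ι → ProbabilityMeasure (EdgeConfig E)} {μ : ProbabilityMeasure (EdgeConfig E)}
    (h : ∀ F, Tendsto (fun i => (μs i : Measure (EdgeConfig E)).real (containing F)) l
      (𝓝 ((μ : Measure (EdgeConfig E)).real (containing F)))) : Tendsto μs l (𝓝 μ) := by
  refine le_nhds_of_unique_clusterPt fun μ' hμ' => ?_
  refine probabilityMeasure_ext fun F => ?_
  obtain ⟨U, hU, hUμ⟩ := mapClusterPt_iff_ultrafilter.1 hμ'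
  exact tendsto_nhds_unique (tendsto_real_of_isClopen hUμ (isClopen_containing F))
    ((h F).mono_left hU)

end EdgeConfig

namespace MultiDigraph

/-! ### The domain Markov property of Gibbs measures -/

section Laws

variable {V E : Type*}

theorem real_map_uniformArborescence [Finite E] {Ω : Type*} [MeasurableSpace Ω]
    (G : MultiDigraph V E) (z : V) (h : ∃ A, G.IsSpanningInArborescence z A) (g : Set E → Ω)
    {S : Set Ω} (hS : MeasurableSet S) :
    ((G.uniformArborescence z h).map g).toMeasure.real S =
      ({A | G.IsSpanningInArborescence z A ∧ g A ∈ S}.ncard : ℝ) /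
        {A | G.IsSpanningInArborescence z A}.ncard := by
  classical
  rw [Measure.real, PMF.toMeasure_apply_eq_toOuterMeasure_apply _ hS, PMF.toOuterMeasure_map_apply,
    uniformArborescence, PMF.toOuterMeasure_uniformOfFinset_apply, ENNReal.toReal_div,
    ENNReal.toReal_natCast, ENNReal.toReal_natCast]
  congr 2
  · rw [← Set.ncard_coe_finset]
    congr 1
    ext A
    simp
  · rw [← Set.ncard_coe_finset]
    congr 1
    ext A
    simp

theorem real_wiredLaw_containing [Countable E] (G : MultiDigraph V E) (hG : G.LocallyFinite)
    (W : Finset V) (h : ∃ A, (G.wired W).IsSpanningInArborescence none A) (F : Finset E) :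
    (G.wiredLaw hG W h : Measure (EdgeConfig E)).real (EdgeConfig.containing F) =
      G.forestProb W F := by
  have := hG.finite_incidentEdges W
  have key : ∀ P : Set E → Prop,
      {A : Set (G.incidentEdges (W : Set V)) |
        (G.wired W).IsSpanningInArborescence none A ∧ P (Subtype.val '' A)}.ncard =
      {B | G.IsRootedForest W B ∧ P B}.ncard := by
    intro P
    refine Set.ncard_congr (fun A _ => Subtype.val '' A) ?_ ?_ ?_
    · rintro A ⟨hA, hP⟩
      exact ⟨(G.wired_isSpanningInArborescence_iff W A).1 hA, hP⟩
    · rintro A B - - hAB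
      exact Set.image_injective.2 Subtype.val_injective hAB
    · rintro B ⟨hB, hP⟩
      obtain ⟨A, rfl⟩ := hB.exists_image_eq
      exact ⟨A, ⟨(G.wired_isSpanningInArborescence_iff W A).2 hB, hP⟩, rfl⟩
  rw [wiredLaw, ProbabilityMeasure.coe_mk, real_map_uniformArborescence _ _ _ _
    (EdgeConfig.isClopen_containing F).isOpen.measurableSet, forestProb]
  have h1 := key fun B => (F : Set E) ⊆ B
  have h2 := key fun _ => True
  simp only [and_true] at h2
  simp only [EdgeConfig.containing, Set.mem_ofPred_eq, EdgeConfig.edges_ofSet, h1, h2]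

/-- The event that the past interior of `Λ` is `W`. -/
def pastInteriorEvent (G : MultiDigraph V E) (Λ W : Finset V) : Set (EdgeConfig E) :=
  {ω | G.pastInterior ω.edges Λ = W}

theorem LocallyFinite.isClopen_pastInterior {G : MultiDigraph V E} (hG : G.LocallyFinite)
    (Λ : Finset V) (P : Set V → Prop) :
    IsClopen {ω : EdgeConfig E | P (G.pastInterior ω.edges Λ)} := by
  have := hG.finite_incidentEdges Λ
  refine EdgeConfig.isClopen_of_finite (T := G.incidentEdges Λ) (Set.toFinite _) ?_
  intro ω ω' h hω
  have : G.pastInterior ω.edges Λ = G.pastInterior ω'.edges Λ :=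
    G.pastInterior_congr fun e he => by simp [EdgeConfig.edges, h e he]
  simpa only [Set.mem_ofPred_eq, this] using hω

/-- The domain Markov property of the law of an approximant that is identified with `G` near
`Λ`. -/
theorem Approximant.real_law_inter [Countable E] {G : MultiDigraph V E} (hG : G.LocallyFinite)
    (a : Approximant G) {Λ W : Finset V} (hW : W ⊆ Λ) (ha : a.iso.IdentifiesNear Λ)
    (hsink : a.sink ∉ a.iso.vertPreimage Λ) {F : Finset E} (hF : ∀ e ∈ F, G.tail e ∈ W)
    (hpos : 0 < {B | G.IsRootedForest W B}.ncard) :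
    (a.law : Measure (EdgeConfig E)).real
        (G.pastInteriorEvent Λ W ∩ EdgeConfig.containing F) =
      G.forestProb W F * (a.law : Measure (EdgeConfig E)).real (G.pastInteriorEvent Λ W) := by
  have hQ : MeasurableSet (G.pastInteriorEvent Λ W) :=
    (hG.isClopen_pastInterior Λ (fun S => S = W)).isOpen.measurableSet
  have hWΛ : (W : Set V) ⊆ Λ := by exact_mod_cast hW
  have hm := ha.mapsOutEdges hWΛ
  set U : Set (Fin a.nV) := {a.sink}ᶜ
  set Wh := a.iso.vertPreimage (W : Set V)
  set Fh := a.iso.symm.edgeImage (F : Set E)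
  have hFh : ∀ e ∈ Fh, a.graph.tail e ∈ Wh := by
    rintro e ⟨e', he', hee⟩
    exact ⟨_, hF e' he', a.iso.tail_mem _ _ (a.iso.edge.mem_iff_mem.1 hee)⟩
  have hWU : Wh ⊆ U := by
    rintro u ⟨w, hw, huw⟩ rfl
    exact hsink ⟨w, hWΛ hw, huw⟩
  have hswap := a.graph.ncard_mul_ncard_isRootedForest (Λ := a.iso.vertPreimage (Λ : Set V))
    hWU hFh
  have hn : {C | a.graph.IsRootedForest Wh C}.ncard = {B | G.IsRootedForest W B}.ncard := by
    have := hm.ncard_isRootedForest (F := ∅) (by simp)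
    simpa [PartialIso.edgeImage] using this
  rw [hm.ncard_isRootedForest (F := (F : Set E)) (by exact_mod_cast hF), hn] at hswap
  rw [law, ProbabilityMeasure.coe_mk, real_map_uniformArborescence _ _ _ _
    (hQ.inter (EdgeConfig.isClopen_containing F).isOpen.measurableSet),
    real_map_uniformArborescence _ _ _ _ hQ]
  have h1 : {A | a.graph.IsSpanningInArborescence a.sink A ∧
      EdgeConfig.ofSet (a.iso.edgeImage A) ∈ G.pastInteriorEvent Λ W} =
      {A | a.graph.IsRootedForest U A ∧
        a.graph.pastInterior A (a.iso.vertPreimage Λ) = Wh} := by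
    ext A
    simp only [pastInteriorEvent, Set.mem_ofPred_eq, EdgeConfig.edges_ofSet,
      isSpanningInArborescence_iff_isRootedForest, ha.pastInterior_eq_iff hWΛ, U, Wh]
  have h2 : {A | a.graph.IsSpanningInArborescence a.sink A ∧
      EdgeConfig.ofSet (a.iso.edgeImage A) ∈
        G.pastInteriorEvent Λ W ∩ EdgeConfig.containing F} =
      {A | a.graph.IsRootedForest U A ∧
        a.graph.pastInterior A (a.iso.vertPreimage Λ) = Wh ∧ Fh ⊆ A} := by
    ext A
    simp only [pastInteriorEvent, EdgeConfig.containing, Set.mem_inter_iff, Set.mem_ofPred_eq,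
      EdgeConfig.edges_ofSet, isSpanningInArborescence_iff_isRootedForest,
      ha.pastInterior_eq_iff hWΛ, U, Wh, Fh,
      hm.edgeImage_symm_subset_iff (F := (F : Set E)) (by exact_mod_cast hF)]
  rw [h1, h2, forestProb]
  have hpos' : (0 : ℝ) < {B | G.IsRootedForest W B}.ncard := by exact_mod_cast hpos
  rw [div_mul_div_comm, mul_comm (({B | G.IsRootedForest (W : Set V) B}.ncard : ℕ) : ℝ),
    ← mul_div_mul_right _ _ hpos'.ne']
  congr 1
  rw [mul_comm (_ : ℝ) ((Set.ncard {A | a.graph.IsRootedForest U A ∧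
        a.graph.pastInterior A (a.iso.vertPreimage Λ) = Wh} : ℕ) : ℝ)]
  exact_mod_cast hswap

theorem real_averagedLaw [Countable E] (G : MultiDigraph V E)
    (ν : ProbabilityMeasure (FiniteApproximation G)) (n : ℕ) {S : Set (EdgeConfig E)}
    (hS : MeasurableSet S) :
    (G.averagedLaw ν n : Measure (EdgeConfig E)).real S =
      ∫ a, ((a.1 n).law : Measure (EdgeConfig E)).real S
        ∂(ν : Measure (FiniteApproximation G)) := by
  rw [averagedLaw, ProbabilityMeasure.coe_mk, Measure.real,
    Measure.bind_apply hS (measurable_law G n).aemeasurable]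
  symm
  exact integral_toReal ((Measure.measurable_coe hS).comp (measurable_law G n)).aemeasurable
    (Eventually.of_forall fun a => measure_lt_top _ _)

/-- The domain Markov property of Gibbs measures: given that the past interior of `Λ` is `W`, the
edges out of `W` form a uniform rooted forest of `W`. -/
theorem IsGibbsMeasure.real_inter [Countable E] {G : MultiDigraph V E} (hG : G.LocallyFinite)
    {μ : ProbabilityMeasure (EdgeConfig E)} (hμ : G.IsGibbsMeasure μ) {Λ W : Finset V}
    (hW : W ⊆ Λ) {F : Finset E} (hF : ∀ e ∈ F, G.tail e ∈ W)
    (hpos : 0 < {B | G.IsRootedForest W B}.ncard) :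
    (μ : Measure (EdgeConfig E)).real (G.pastInteriorEvent Λ W ∩ EdgeConfig.containing F) =
      G.forestProb W F * (μ : Measure (EdgeConfig E)).real (G.pastInteriorEvent Λ W) := by
  obtain ⟨-, ν, hν⟩ := hμ
  set p := G.forestProb W F
  set Q := G.pastInteriorEvent Λ W
  have hQ : IsClopen Q := hG.isClopen_pastInterior Λ (fun S => S = W)
  have hQF : IsClopen (Q ∩ EdgeConfig.containing F) := hQ.inter (EdgeConfig.isClopen_containing F)
  have h1 := (EdgeConfig.tendsto_real_of_isClopen hν hQF).sub
    ((EdgeConfig.tendsto_real_of_isClopen hν hQ).const_mul p)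
  refine sub_eq_zero.1 (tendsto_nhds_unique h1 ?_)
  have hmeas : ∀ n {S : Set (EdgeConfig E)}, MeasurableSet S →
      Measurable fun a : FiniteApproximation G =>
        ((a.1 n).law : Measure (EdgeConfig E)).real S := fun n S hS =>
    ((Measure.measurable_coe hS).comp (measurable_law G n)).ennreal_toReal
  have hint : ∀ n {S : Set (EdgeConfig E)}, MeasurableSet S →
      Integrable (fun a : FiniteApproximation G =>
        ((a.1 n).law : Measure (EdgeConfig E)).real S)
        (ν : Measure (FiniteApproximation G)) := fun n S hS =>
    Integrable.of_bound (hmeas n hS).aestronglyMeasurable 1 (Eventually.of_forall fun a => by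
      rw [Real.norm_of_nonneg measureReal_nonneg]; exact measureReal_le_one)
  have h2 : ∀ n, (G.averagedLaw ν n : Measure (EdgeConfig E)).real
      (Q ∩ EdgeConfig.containing F) - p * (G.averagedLaw ν n : Measure (EdgeConfig E)).real Q =
      ∫ a, (((a.1 n).law : Measure (EdgeConfig E)).real (Q ∩ EdgeConfig.containing F) -
        p * ((a.1 n).law : Measure (EdgeConfig E)).real Q)
        ∂(ν : Measure (FiniteApproximation G)) := by
    intro n
    rw [real_averagedLaw G ν n hQF.isOpen.measurableSet,
      real_averagedLaw G ν n hQ.isOpen.measurableSet,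
      integral_sub (hint n hQF.isOpen.measurableSet) ((hint n hQ.isOpen.measurableSet).const_mul p),
      integral_const_mul]
  simp_rw [h2]
  rw [← integral_zero (FiniteApproximation G) ℝ (μ := (ν : Measure (FiniteApproximation G)))]
  -- The integrand vanishes as soon as the approximant is identified with `G` near `Λ`.
  refine tendsto_integral_of_dominated_convergence (fun _ => 1 + |p|)
    (fun n => ((hmeas n hQF.isOpen.measurableSet).sub
      ((hmeas n hQ.isOpen.measurableSet).const_mul p)).aestronglyMeasurable)
    (integrable_const _) (fun n => Eventually.of_forall fun a => ?_)
    (Eventually.of_forall fun a => ?_)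
  · refine (norm_sub_le _ _).trans (add_le_add ?_ ?_)
    · rw [Real.norm_of_nonneg measureReal_nonneg]; exact measureReal_le_one
    · rw [norm_mul, Real.norm_of_nonneg measureReal_nonneg, Real.norm_eq_abs]
      exact mul_le_of_le_one_right (abs_nonneg p) measureReal_le_one
  · obtain ⟨N₁, hN₁⟩ := a.2.identification Λ
    obtain ⟨N₂, hN₂⟩ := a.2.sink_escapes Λ
    refine tendsto_const_nhds.congr' ?_
    filter_upwards [eventually_ge_atTop N₁, eventually_ge_atTop N₂] with n hn₁ hn₂
    exact (sub_eq_zero.2 (Approximant.real_law_inter hG (a.1 n) hW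
      ⟨(hN₁ n hn₁).1, (hN₁ n hn₁).2⟩ (hN₂ n hn₂) hF hpos)).symm

/-- The probabilities, under a Gibbs measure with one-ended components, that given edges are
present are the limits of the corresponding probabilities for uniform rooted forests. -/
theorem IsGibbsMeasure.real_containing_eq [Countable V] [Countable E] {G : MultiDigraph V E}
    (hG : G.LocallyFinite) {μ : ProbabilityMeasure (EdgeConfig E)} (hμ : G.IsGibbsMeasure μ)
    (hone : ∀ᵐ ω ∂(μ : Measure (EdgeConfig E)), G.ComponentsOneEnded ω.edges)
    (hpos : ∀ W : Finset V, 0 < {B | G.IsRootedForest W B}.ncard) {F : Finset E} {c : ℝ}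
    (hc : Tendsto (fun W : Finset V => G.forestProb W F) atTop (𝓝 c)) :
    (μ : Measure (EdgeConfig E)).real (EdgeConfig.containing F) = c := by
  classical
  set m := (μ : Measure (EdgeConfig E))
  refine eq_of_abs_sub_le_all fun ε hε => ?_
  obtain ⟨W₀, hW₀⟩ := eventually_atTop.1 ((hc.eventually (Metric.closedBall_mem_nhds c hε)).and
    (eventually_ge_atTop (F.image G.tail)))
  have htail : ∀ W ≥ W₀, ∀ e ∈ F, G.tail e ∈ W := fun W hW e he =>
    (hW₀ W hW).2 (Finset.mem_image_of_mem _ he)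
  let D : Finset V → Set (EdgeConfig E) := fun Λ => {ω | (W₀ : Set V) ⊆ G.pastInterior ω.edges Λ}
  have hmono : Monotone D := by
    intro Λ₁ Λ₂ hΛ ω hω x hx
    exact Set.Subset.trans (hω hx) (by exact_mod_cast hΛ)
  -- One-endedness: the past of `W₀` is contained in large finite sets.
  have hD : ∀ᵐ ω ∂m, ω ∈ ⋃ Λ, D Λ := by
    filter_upwards [hone] with ω hω
    have hfin : (⋃ u ∈ (W₀ : Set V), G.past ω.edges u).Finite :=
      W₀.finite_toSet.biUnion fun u _ => hω u
    refine Set.mem_iUnion.2 ⟨hfin.toFinset, fun x hx y hy => ?_⟩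
    simp only [Set.Finite.coe_toFinset]
    exact Set.mem_biUnion hx hy
  have hlim : ∀ S, Tendsto (fun Λ => m.real (D Λ ∩ S)) atTop (𝓝 (m.real S)) := by
    intro S
    have h1 := tendsto_measure_iUnion_atTop (μ := m)
      (s := fun Λ => D Λ ∩ S) fun _ _ h => Set.inter_subset_inter_left _ (hmono h)
    have h2 : m (⋃ Λ, D Λ ∩ S) = m S := by
      refine measure_congr ?_
      filter_upwards [hD] with ω hω
      rw [← Set.iUnion_inter]
      exact propext ⟨fun h => h.2, fun h => ⟨hω, h⟩⟩
    rw [h2] at h1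
    exact (ENNReal.tendsto_toReal (measure_ne_top m S)).comp h1
  -- Decompose according to the value of the past interior.
  have hdecomp : ∀ Λ S, MeasurableSet S → m.real (D Λ ∩ S) =
      ∑ W ∈ Λ.powerset.filter (W₀ ⊆ ·), m.real (G.pastInteriorEvent Λ W ∩ S) := by
    intro Λ S hS
    rw [← measureReal_biUnion_finset]
    · congr 1
      ext ω
      simp only [Set.mem_inter_iff, Set.mem_iUnion, Finset.mem_filter, Finset.mem_powerset,
        exists_prop, pastInteriorEvent, Set.mem_ofPred_eq, D]
      constructor
      · rintro ⟨h1, h2⟩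
        have hfin : (G.pastInterior ω.edges Λ).Finite :=
          Λ.finite_toSet.subset (G.pastInterior_subset _ _)
        refine ⟨hfin.toFinset, ⟨?_, ?_⟩, by simp, h2⟩
        · intro x hx
          exact G.pastInterior_subset _ _ (hfin.mem_toFinset.1 hx)
        · intro x hx
          exact hfin.mem_toFinset.2 (h1 hx)
      · rintro ⟨W, ⟨-, h1⟩, h2, h3⟩
        exact ⟨h2 ▸ (by exact_mod_cast h1), h3⟩
    · intro W₁ _ W₂ _ hne
      refine Set.disjoint_left.2 fun ω h1 h2 => hne ?_
      have : (W₁ : Set V) = W₂ := (h1.1 : _ = _).symm.trans h2.1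
      exact_mod_cast this
    · intro W _
      exact (hG.isClopen_pastInterior Λ (fun S => S = W)).isOpen.measurableSet.inter hS
  have hΛ : ∀ Λ, |m.real (D Λ ∩ EdgeConfig.containing F) - c * m.real (D Λ ∩ Set.univ)| ≤ ε := by
    intro Λ
    rw [hdecomp Λ _ (EdgeConfig.isClopen_containing F).isOpen.measurableSet,
      hdecomp Λ _ MeasurableSet.univ, Finset.mul_sum, ← Finset.sum_sub_distrib]
    refine (Finset.abs_sum_le_sum_abs _ _).trans ?_
    have hle : ∀ W ∈ Λ.powerset.filter (W₀ ⊆ ·),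
        |m.real (G.pastInteriorEvent Λ W ∩ EdgeConfig.containing F) -
          c * m.real (G.pastInteriorEvent Λ W ∩ Set.univ)| ≤
        ε * m.real (G.pastInteriorEvent Λ W ∩ Set.univ) := by
      intro W hW
      obtain ⟨hWΛ, hW₀W⟩ := Finset.mem_filter.1 hW
      rw [hμ.real_inter hG (Finset.mem_powerset.1 hWΛ) (htail W hW₀W) (hpos W), Set.inter_univ,
        ← sub_mul, abs_mul, abs_of_nonneg (measureReal_nonneg (μ := m))]
      gcongr
      exact (hW₀ W hW₀W).1
    refine (Finset.sum_le_sum hle).trans ?_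
    rw [← Finset.mul_sum, ← hdecomp Λ _ MeasurableSet.univ]
    exact mul_le_of_le_one_right hε.le measureReal_le_one
  have hfinal := ((hlim (EdgeConfig.containing F)).sub ((hlim Set.univ).const_mul c)).abs
  rw [probReal_univ, mul_one] at hfinal
  exact le_of_tendsto hfinal (Eventually.of_forall hΛ)

end Laws

end MultiDigraph

/-! ### Uniqueness of the Gibbs measure -/

theorem mainTheorem4 {V : Type*} {E : Type*} [Countable V] [Countable E] [Infinite V]
    (G : MultiDigraph V E) (hG : G.LocallyFinite) (hconn : G.IsConnected)
    (htrans : G.IsTransient hG) :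
    (∀ μ₁ μ₂ : ProbabilityMeasure (EdgeConfig E),
      G.IsGibbsMeasure μ₁ →
      (∀ᵐ ω ∂(μ₁ : Measure (EdgeConfig E)), G.ComponentsOneEnded ω.edges) →
      G.IsGibbsMeasure μ₂ →
      (∀ᵐ ω ∂(μ₂ : Measure (EdgeConfig E)), G.ComponentsOneEnded ω.edges) →
      μ₁ = μ₂) ∧
    ∀ μ : ProbabilityMeasure (EdgeConfig E),
      G.IsGibbsMeasure μ →
      (∀ᵐ ω ∂(μ : Measure (EdgeConfig E)), G.ComponentsOneEnded ω.edges) →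
      G.IsWiredUniformArboretum hG μ := by
  have hne : ∀ v, (G.outEdges v).Nonempty := htrans.1
  have hs := htrans.summable_killedProb
  have hpos := MultiDigraph.ncard_isRootedForest_pos (G := G) hs hne
  choose c hc using MultiDigraph.exists_tendsto_forestProb (G := G) hs hne
  refine ⟨fun μ₁ μ₂ h₁ h₁' h₂ h₂' => EdgeConfig.probabilityMeasure_ext fun F => ?_,
    fun μ hμ hone W hW => ?_⟩
  · rw [h₁.real_containing_eq hG h₁' hpos (hc F), h₂.real_containing_eq hG h₂' hpos (hc F)]
  · have hex : ∀ n, ∃ A, (G.wired (W n)).IsSpanningInArborescence none A := by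
      intro n
      obtain ⟨B, hB⟩ := (Set.ncard_pos (Set.finite_of_ncard_pos (hpos (W n)))).1 (hpos (W n))
      obtain ⟨A, rfl⟩ := MultiDigraph.IsRootedForest.exists_image_eq hB
      exact ⟨A, (G.wired_isSpanningInArborescence_iff _ A).2 hB⟩
    refine ⟨hex, EdgeConfig.tendsto_of_tendsto_containing fun F => ?_⟩
    simp_rw [G.real_wiredLaw_containing hG]
    rw [hμ.real_containing_eq hG hone hpos (hc F)]
    exact (hc F).comp (tendsto_atTop_finset_of_monotone hW.1 hW.2)
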